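/- All graphs are finite and simple. For a graph $G$ let $\Delta(G)$ be its maximum degree and $\chi'(G)$ its chromatic index, i.e. the least number of colors in an edge-coloring in which no two distinct edges sharing an endpoint receive the same color. $G$ is of Class 1 if $\chi'(G)=\Delta(G)$ and of Class 2 otherwise; it is overfull if $|E(G)|>\Delta(G)\lfloor |V(G)|/2\rfloor$. An edge $e$ of $G$ is critical if $\chi'(G-e)<\chi'(G)$. $G$ is $\Delta$-critical if $\Delta(G)=\Delta$, $\chi'(G)=\Delta+1$, and $\chi'(H)<\chi'(G)$ for every proper subgraph $H$ of $G$. A graph is obtained from a graph $G_0$ by a vertex-splitting if, for some vertex $v$ of $G_0$ and some partition of the neighborhood $N_{G_0}(v)$ into two nonempty sets $N_1,N_2$, it arises by replacing $v$ with two new adjacent vertices $v_1,v_2$, where the neighbors of $v_i$ among the old vertices are exactly the members of $N_i$. **Theorem.** Let $n$ and $\Delta$ be positive integers with $\Delta\ge\frac{2n-4}{3}$. If an $n$-vertex graph $G$ is obtained by a vertex-splitting from an $(n-1)$-vertex connected $\Delta$-regular Class 1 graph, then $G$ is overfull, $G$ is of Class 2, every edge of $G$ is critical, and $G$ is $\Delta$-critical.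 (In terms of the order $m=n-1$ of the original graph, the hypothesis reads $\Delta\ge\frac{2m-2}{3}$.) -/

import Mathlib

namespace VertexSplitting

open SimpleGraph

/-- The chromatic index: the least number of colors in a proper edge-coloring, i.e. a coloring of
the edges in which distinct edges that share an endpoint get distinct colors. -/
noncomputable def chromaticIndex {V : Type*} (G : SimpleGraph V) : ℕ∞ :=
  G.lineGraph.chromaticNumber

/-- `G` is of Class 1 if its chromatic index equals its maximum degree. -/
def IsClassOne {V : Type*} [Fintype V] (G : SimpleGraph V) [DecidableRel G.Adj] : Prop :=
  chromaticIndex G = (G.maxDegree : ℕ∞)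

/-- `G` is of Class 2 if it is not of Class 1. -/
def IsClassTwo {V : Type*} [Fintype V] (G : SimpleGraph V) [DecidableRel G.Adj] : Prop :=
  ¬ IsClassOne G

/-- `G` is overfull if `|E(G)| > Δ(G) ⌊|V(G)| / 2⌋`. -/
def IsOverfull {V : Type*} [Fintype V] (G : SimpleGraph V) [DecidableRel G.Adj] : Prop :=
  G.maxDegree * (Fintype.card V / 2) < G.edgeFinset.card

/-- The edge `e` is critical if deleting it decreases the chromatic index. -/
def IsCriticalEdge {V : Type*} (G : SimpleGraph V) (e : Sym2 V) : Prop :=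
  e ∈ G.edgeSet ∧ chromaticIndex (G.deleteEdges {e}) < chromaticIndex G

/-- `G` is edge-chromatic critical if every proper subgraph (on any set of vertices) has smaller
chromatic index. -/
def IsEdgeChromaticCritical {V : Type*} (G : SimpleGraph V) : Prop :=
  ∀ H : G.Subgraph, H ≠ ⊤ → chromaticIndex H.coe < chromaticIndex G

/-- `G` is `Δ`-critical if `Δ` is its maximum degree, it is edge-chromatic critical, and its
chromatic index is `Δ + 1`. -/
def IsDeltaCritical {V : Type*} [Fintype V] (G : SimpleGraph V) [DecidableRel G.Adj]
    (Δ : ℕ) : Prop :=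
  G.maxDegree = Δ ∧ IsEdgeChromaticCritical G ∧ chromaticIndex G = (Δ : ℕ∞) + 1

/-- The adjacency relation after replacing `v` by two adjacent vertices
`v₁ = Sum.inr false`, `v₂ = Sum.inr true`, whose neighbors among the old vertices are
the members of `N₁` and `N₂` respectively. -/
def splitAdj {W : Type*} (G : SimpleGraph W) (v : W) (N₁ N₂ : Set W) :
    {w : W // w ≠ v} ⊕ Bool → {w : W // w ≠ v} ⊕ Bool → Prop
  | Sum.inl x, Sum.inl y => G.Adj x y
  | Sum.inl x, Sum.inr false => (x : W) ∈ N₁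
  | Sum.inl x, Sum.inr true => (x : W) ∈ N₂
  | Sum.inr false, Sum.inl y => (y : W) ∈ N₁
  | Sum.inr true, Sum.inl y => (y : W) ∈ N₂
  | Sum.inr i, Sum.inr j => i ≠ j

/-- The graph obtained from `G` by replacing `v` by two adjacent vertices with old neighbors
`N₁` and `N₂`. -/
def splitGraph {W : Type*} (G : SimpleGraph W) (v : W) (N₁ N₂ : Set W) :
    SimpleGraph ({w : W // w ≠ v} ⊕ Bool) where
  Adj := splitAdj G v N₁ N₂
  symm := ⟨by
    rintro (x | (_ | _)) (y | (_ | _)) h <;> simp_all [splitAdj, G.adj_comm]⟩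
  loopless := ⟨by
    rintro (x | (_ | _)) h <;> simp_all [splitAdj]⟩

/-- `G` is (up to isomorphism) obtained from `G₀` by a vertex-splitting: for some vertex `v` and
some partition of the neighborhood of `v` into two nonempty sets, `G` is the split graph. -/
def IsVertexSplitting {W V : Type*} (G₀ : SimpleGraph W) (G : SimpleGraph V) : Prop :=
  ∃ (v : W) (N₁ N₂ : Set W), N₁.Nonempty ∧ N₂.Nonempty ∧ Disjoint N₁ N₂ ∧
    N₁ ∪ N₂ = G₀.neighborSet v ∧ Nonempty (G ≃g splitGraph G₀ v N₁ N₂)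

end VertexSplitting

/-!
A `Δ`-edge-coloring of the `Δ`-regular graph `G₀` uses every color at every vertex, so `G₀` has
even order and the splitting, with one more vertex and one more edge, is overfull. Everything
reduces to `Δ`-coloring the split graph minus an arbitrary edge. For an edge at a half of `v` the
given coloring of `G₀` will do.

For an old edge `wz`, delete `v` and cut `wz`, keeping the half-edges. Switching two colors along
alternating chains changes the colors of these terminals in pairs. If the chain from the cut of
`wz` ends at a suitable neighbor of `v`, the resulting coloring extends to the new edge; otherwise
the switch exchanges the two colors at `w` without affecting `v`, so the color of a given edge at
`w` may be assumed to occur between `v` and `N₂`. This settles the case that `w` or `z` is a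
neighbor of `v`. In the remaining case the degree bound provides a common neighbor `x` of `v`, `w`
and `z`, through which colors can be exchanged if `N₁` and `N₂` both have at least two elements. If
`N₂ = {s}`, also delete `x` and cut `vs`: the chains between eight of the resulting terminals, in
four colors, are handled by a finite case analysis.
-/

namespace VertexSplitting

open Function SimpleGraph

section AlternatingChain

variable {D C : Type*} {σ τ : Equiv.Perm D} {l d : D}

theorem apply_zpow_mul_apply (hσ : Involutive σ) (hτ : Involutive τ) (hl : σ l = l) (n : ℤ) :
    σ (((σ * τ) ^ n) l) = ((σ * τ) ^ (-n)) l := by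
  have hσσ : σ * σ = 1 := Equiv.ext hσ
  have hσ' : σ⁻¹ = σ := inv_eq_of_mul_eq_one_left hσσ
  have hτ' : τ⁻¹ = τ := inv_eq_of_mul_eq_one_left (Equiv.ext hτ)
  have hconj : σ * (σ * τ) * σ⁻¹ = (σ * τ)⁻¹ := by
    rw [mul_inv_rev, hτ', hσ', ← mul_assoc, hσσ, one_mul]
  have hpow : σ * (σ * τ) ^ n * σ⁻¹ = (σ * τ) ^ (-n) := by
    rw [← conj_zpow, hconj, inv_zpow, zpow_neg]
  rw [← hpow, hσ', Equiv.Perm.mul_apply, hl, Equiv.Perm.mul_apply]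

theorem apply_zpow_mul_apply' (hσ : Involutive σ) (hτ : Involutive τ) (hl : σ l = l) (n : ℤ) :
    τ (((σ * τ) ^ n) l) = ((σ * τ) ^ (-(n + 1))) l := by
  rw [← apply_zpow_mul_apply hσ hτ hl, add_comm, zpow_add, zpow_one, Equiv.Perm.mul_apply,
    Equiv.Perm.mul_apply, hσ]

-- If the cycle of `l` under `σ * τ` has length `2 * k`, then `σ` fixes `(σ * τ) ^ n` of `l` exactly
-- when `k ∣ n`, so that the only other fixed point is at distance `k`.
theorem existsUnique_sameCycle_mul_of_fixed [Finite D] (hσ : Involutive σ) (hτ : Involutive τ)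
    (hl : σ l = l) (hτl : ∀ d, (σ * τ).SameCycle l d → τ d ≠ d) :
    ∃! m, m ≠ l ∧ (σ * τ).SameCycle l m ∧ σ m = m := by
  set θ := σ * τ
  have hper (n : ℤ) : (θ ^ n) l = l ↔ (minimalPeriod θ l : ℤ) ∣ n :=
    MulAction.zpow_smul_eq_iff_minimalPeriod_dvd (a := θ) (b := l)
  have heq (m n : ℤ) : (θ ^ m) l = (θ ^ n) l ↔ (minimalPeriod θ l : ℤ) ∣ m - n := by
    rw [← hper, sub_eq_neg_add, zpow_add, Equiv.Perm.mul_apply, zpow_neg,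
      Equiv.Perm.inv_eq_iff_eq]
  have hpos : 0 < minimalPeriod θ l :=
    minimalPeriod_pos_of_mem_periodicPts (θ.injective.mem_periodicPts l)
  obtain ⟨k, hk | hk⟩ := Nat.even_or_odd' (minimalPeriod θ l)
  · have hfix (n : ℤ) : σ ((θ ^ n) l) = (θ ^ n) l ↔ (k : ℤ) ∣ n := by
      rw [apply_zpow_mul_apply hσ hτ hl, heq, hk, Nat.cast_mul, Nat.cast_ofNat,
        show -n - n = 2 * -n by ring, mul_dvd_mul_iff_left two_ne_zero, dvd_neg]
    refine ⟨(θ ^ (k : ℤ)) l, ⟨?_, ⟨k, rfl⟩, (hfix k).2 dvd_rfl⟩, ?_⟩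
    · rw [Ne, hper, Int.natCast_dvd_natCast]
      exact Nat.not_dvd_of_pos_of_lt (by lia) (by lia)
    · rintro _ ⟨hne, ⟨n, rfl⟩, hn⟩
      obtain ⟨j, rfl⟩ := (hfix n).1 hn
      rw [Ne, hper] at hne
      rw [heq]
      obtain ⟨i, rfl | rfl⟩ := Int.even_or_odd' j
      · exact absurd ⟨i, by rw [hk]; push_cast; ring⟩ hne
      · exact ⟨i, by rw [hk]; push_cast; ring⟩
  · refine absurd ?_ (hτl ((θ ^ (k : ℤ)) l) ⟨k, rfl⟩)
    rw [apply_zpow_mul_apply' hσ hτ hl, heq]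
    exact ⟨-1, by rw [hk]; push_cast; ring⟩

/-- A pairing of the ends of the alternating chains of a Kempe change: for terminals `T` colored by
`μ` and an involution `e` of the colors, `π` matches each terminal whose color is moved by `e` with
the other end of its chain, which has the same color up to `e`. -/
def IsKempePairing (T : Set D) (μ : D → C) (e : C → C) (π : D → D) : Prop :=
  ∀ k ∈ T, e (μ k) ≠ μ k →
    π k ∈ T ∧ π k ≠ k ∧ π (π k) = k ∧ (μ (π k) = μ k ∨ μ (π k) = e (μ k))

variable {A : Set D} {μ : D → C} {e : C → C}

theorem mem_and_color_of_sameCycle_mul [Finite D] (he : Involutive e)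
    (hσA : ∀ d ∈ A, σ d ∈ A ∧ μ (σ d) = μ d) (hτA : ∀ d ∈ A, τ d ∈ A ∧ μ (τ d) = e (μ d))
    (hl : l ∈ A) (h : (σ * τ).SameCycle l d) : d ∈ A ∧ (μ d = μ l ∨ μ d = e (μ l)) := by
  obtain ⟨n, rfl⟩ := h.exists_nat_pow_eq
  clear h
  induction n with
  | zero => exact ⟨hl, Or.inl rfl⟩
  | succ n ih =>
    obtain ⟨hA, hcol⟩ := hτA _ ih.1
    rw [pow_succ', Equiv.Perm.mul_apply, Equiv.Perm.mul_apply, (hσA _ hA).2, hcol]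
    refine ⟨(hσA _ hA).1, ?_⟩
    rcases ih.2 with h | h <;> rw [h]
    · exact Or.inr rfl
    · exact Or.inl (he _)

theorem sameCycle_mul_apply (hσ : Involutive σ) (hτ : Involutive τ) (hl : σ l = l)
    (h : (σ * τ).SameCycle l d) : (σ * τ).SameCycle l (σ d) ∧ (σ * τ).SameCycle l (τ d) := by
  obtain ⟨n, rfl⟩ := h
  exact ⟨⟨-n, (apply_zpow_mul_apply hσ hτ hl n).symm⟩,
    ⟨-(n + 1), (apply_zpow_mul_apply' hσ hτ hl n).symm⟩⟩

theorem exists_isKempePairing [Finite D] (hσ : Involutive σ) (hτ : Involutive τ)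
    (he : Involutive e) (hσA : ∀ d ∈ A, σ d ∈ A ∧ μ (σ d) = μ d)
    (hτA : ∀ d ∈ A, τ d ∈ A ∧ μ (τ d) = e (μ d)) :
    ∃ π, IsKempePairing {l ∈ A | σ l = l} μ e π ∧ ∀ S, Set.MapsTo π S S →
      ∃ O, Set.MapsTo σ O O ∧ Set.MapsTo τ O O ∧
        ∀ l ∈ A, σ l = l → e (μ l) ≠ μ l → (l ∈ O ↔ l ∈ S) := by
  classical
  have hchain {l d} (hl : l ∈ A) (h : (σ * τ).SameCycle l d) :=
    mem_and_color_of_sameCycle_mul he hσA hτA hl h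
  have hmove {l d} (hl : l ∈ A) (hne : e (μ l) ≠ μ l) (h : (σ * τ).SameCycle l d) :
      e (μ d) ≠ μ d := by
    rcases (hchain hl h).2 with h | h <;> rw [h]
    · exact hne
    · rw [he]
      exact hne.symm
  have hend (l) (hl : l ∈ A) (hσl : σ l = l) (hne : e (μ l) ≠ μ l) :=
    existsUnique_sameCycle_mul_of_fixed hσ hτ hσl fun d hd hτd =>
      hmove hl hne hd (by rw [← (hτA d (hchain hl hd).1).2, hτd])
  choose! π hπ hπuniq using hend
  refine ⟨π, ?_, fun S hS => ⟨{d | ∃ l ∈ S, l ∈ A ∧ σ l = l ∧ e (μ l) ≠ μ l ∧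
    (σ * τ).SameCycle l d}, ?_, ?_, fun d hd hσd hne => ⟨?_, ?_⟩⟩⟩
  · rintro l ⟨hl, hσl⟩ hne
    obtain ⟨hπl, hcyc, hσπ⟩ := hπ l hl hσl hne
    obtain ⟨hA, hcol⟩ := hchain hl hcyc
    exact ⟨⟨hA, hσπ⟩, hπl,
      (hπuniq _ hA hσπ (hmove hl hne hcyc) l ⟨hπl.symm, hcyc.symm, hσl⟩).symm, hcol⟩
  · rintro d ⟨l, hlS, hl, hσl, hne, h⟩
    exact ⟨l, hlS, hl, hσl, hne, (sameCycle_mul_apply hσ hτ hσl h).1⟩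
  · rintro d ⟨l, hlS, hl, hσl, hne, h⟩
    exact ⟨l, hlS, hl, hσl, hne, (sameCycle_mul_apply hσ hτ hσl h).2⟩
  · rintro ⟨l, hlS, hl, hσl, hne, h⟩
    obtain rfl | hdl := eq_or_ne d l
    · exact hlS
    · rw [hπuniq l hl hσl hne d ⟨hdl, h, hσd⟩]
      exact hS hlS
  · exact fun hdS => ⟨d, hdS, hd, hσd, hne, Equiv.Perm.SameCycle.refl _ _⟩

end AlternatingChain

section Pole

variable {W C : Type*} {G : SimpleGraph W}

/-- A pole coloring of `G`: delete the vertices of `R`, keeping the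
half-edges that point to them, and cut the edges of `K` into two half-edges each. `f u y` is the
color of the half-edge at `u` pointing to `y`; every remaining vertex sees every color once. -/
structure IsPoleColoring (G : SimpleGraph W) (R : Set W) (K : Set (Sym2 W)) (f : W → W → C) :
    Prop where
  bijOn : ∀ u ∉ R, Set.BijOn (f u) (G.neighborSet u) Set.univ
  symm : ∀ u y, G.Adj u y → u ∉ R → y ∉ R → s(u, y) ∉ K → f u y = f y u

/-- The half-edges of the pole with deleted vertices `R`. -/
def halfEdges (G : SimpleGraph W) (R : Set W) : Set (W × W) := {l | G.Adj l.1 l.2 ∧ l.1 ∉ R}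

/-- The half-edges of a pole that are not part of a whole edge. -/
def IsTerminal (G : SimpleGraph W) (R : Set W) (K : Set (Sym2 W)) (l : W × W) : Prop :=
  G.Adj l.1 l.2 ∧ l.1 ∉ R ∧ (l.2 ∈ R ∨ s(l.1, l.2) ∈ K)

variable {R : Set W} {K : Set (Sym2 W)} {f : W → W → C}

theorem exists_involutive_of_bijOn {h : W → C} {s : Set W}
    (hh : Set.BijOn h s Set.univ) {e : C → C} (he : Involutive e) :
    ∃ t : W → W, Involutive t ∧ Set.MapsTo t s s ∧ ∀ y ∈ s, h (t y) = e (h y) := by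
  classical
  choose g hgs hg using fun c => hh.surjOn (Set.mem_univ c)
  refine ⟨fun y => if y ∈ s then g (e (h y)) else y, fun y => ?_, fun y hy => ?_, fun y hy => ?_⟩
  · by_cases hy : y ∈ s
    · simp only [hy, hgs, if_true, hg, he (h y)]
      exact hh.injOn (hgs _) hy (hg _)
    · simp only [hy, if_false]
  · simpa only [hy, if_true] using hgs _
  · simp only [hy, if_true, hg]

theorem bijOn_comp_swap [DecidableEq W] {s : Set W} {h : W → C} (hh : Set.BijOn h s Set.univ)
    {y₁ y₂ : W} (h₁ : y₁ ∈ s) (h₂ : y₂ ∈ s) :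
    Set.BijOn (fun y => h (Equiv.swap y₁ y₂ y)) s Set.univ :=
  hh.comp (Equiv.swap_bijOn_self (iff_of_true h₁ h₂))

theorem IsPoleColoring.mono (hf : IsPoleColoring G R K f) {R' : Set W} {K' : Set (Sym2 W)}
    (hR : R ⊆ R') (hK : ∀ u y, s(u, y) ∈ K → s(u, y) ∈ K' ∨ u ∈ R' ∨ y ∈ R') :
    IsPoleColoring G R' K' f where
  bijOn u hu := hf.bijOn u fun h => hu (hR h)
  symm u y huy hu hy hK' := hf.symm u y huy (fun h => hu (hR h)) (fun h => hy (hR h)) fun h => by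
    rcases hK u y h with h | h | h
    exacts [hK' h, hu h, hy h]

theorem IsPoleColoring.glue (hf : IsPoleColoring G R K f)
    (h : ∀ u y, s(u, y) ∈ K → f u y = f y u) : IsPoleColoring G R ∅ f where
  bijOn := hf.bijOn
  symm u y huy hu hy _ := by
    by_cases hK : s(u, y) ∈ K
    · exact h u y hK
    · exact hf.symm u y huy hu hy hK

open Classical in
theorem IsPoleColoring.restore {x : W} (hf : IsPoleColoring G (insert x R) K f) {h : W → C}
    (hh : Set.BijOn h (G.neighborSet x) Set.univ)
    (hfit : ∀ y, G.Adj x y → y ∉ R → s(x, y) ∉ K → h y = f y x) :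
    IsPoleColoring G R K (update f x h) := by
  refine ⟨fun u hu => ?_, fun u y huy hu hy hK => ?_⟩
  · obtain rfl | hux := eq_or_ne u x
    · simpa only [update_self] using hh
    · simpa only [update_of_ne hux] using hf.bijOn u (by simp [hux, hu])
  · obtain rfl | hux := eq_or_ne u x
    · rw [update_self, update_of_ne huy.ne', hfit y huy hy hK]
    · obtain rfl | hyx := eq_or_ne y x
      · rw [update_self, update_of_ne hux, hfit u huy.symm hu (by rwa [Sym2.eq_swap])]
      · rw [update_of_ne hux, update_of_ne hyx]
        exact hf.symm u y huy (by simp [hux, hu]) (by simp [hyx, hy]) hK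

open Classical in
theorem IsPoleColoring.exchange (hf : IsPoleColoring G R K f) {u y₁ y₂ : W}
    (h₁ : IsTerminal G R K (u, y₁)) (h₂ : IsTerminal G R K (u, y₂)) :
    IsPoleColoring G R K (update f u fun y => f u (Equiv.swap y₁ y₂ y)) := by
  refine (hf.mono (Set.subset_insert u R) fun _ _ => Or.inl).restore
    (bijOn_comp_swap (hf.bijOn u h₁.2.1) h₁.1 h₂.1) fun y hy hyR hyK => ?_
  rw [Equiv.swap_apply_of_ne_of_ne]
  · exact hf.symm u y hy h₁.2.1 hyR hyK
  · rintro rfl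
    exact h₁.2.2.elim hyR hyK
  · rintro rfl
    exact h₂.2.2.elim hyR hyK

theorem IsPoleColoring.exists_mate (hf : IsPoleColoring G R K f) :
    ∃ σ : Equiv.Perm (W × W), Involutive σ ∧
      (∀ l ∈ halfEdges G R, σ l ∈ halfEdges G R ∧ uncurry f (σ l) = uncurry f l) ∧
      (∀ l ∈ halfEdges G R, σ l = l ↔ IsTerminal G R K l) ∧
      ∀ u y, G.Adj u y → u ∉ R → y ∉ R → s(u, y) ∉ K → σ (u, y) = (y, u) := by
  classical
  let inner (l : W × W) : Prop := G.Adj l.1 l.2 ∧ l.1 ∉ R ∧ l.2 ∉ R ∧ s(l.1, l.2) ∉ K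
  have inner_swap (l : W × W) (h : inner l) : inner l.swap :=
    ⟨h.1.symm, h.2.2.1, h.2.1, fun h' => h.2.2.2 (by rwa [Sym2.eq_swap])⟩
  have hinv : Involutive fun l => if inner l then l.swap else l := fun l => by
    by_cases h : inner l
    · simp only [h, inner_swap l h, if_true, Prod.swap_swap]
    · simp only [h, if_false]
  refine ⟨hinv.toPerm, hinv, fun l hl => ?_, fun l hl => ?_, fun u y huy hu hy hK =>
    if_pos ⟨huy, hu, hy, hK⟩⟩
  all_goals
    simp only [Involutive.coe_toPerm]
    split_ifs with h
  · exact ⟨⟨h.1.symm, h.2.2.1⟩, (hf.symm l.1 l.2 h.1 h.2.1 h.2.2.1 h.2.2.2).symm⟩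
  · exact ⟨hl, rfl⟩
  · exact iff_of_false (fun heq => hl.1.ne (congrArg Prod.snd heq)) fun ht =>
      ht.2.2.elim h.2.2.1 h.2.2.2
  · refine iff_of_true rfl ⟨hl.1, hl.2, ?_⟩
    by_contra! hn
    exact h ⟨hl.1, hl.2, hn⟩

theorem IsPoleColoring.exists_turn (hf : IsPoleColoring G R K f) {e : C → C} (he : Involutive e) :
    ∃ τ : Equiv.Perm (W × W), Involutive τ ∧ (∀ l, (τ l).1 = l.1) ∧
      ∀ l ∈ halfEdges G R, τ l ∈ halfEdges G R ∧ uncurry f (τ l) = e (uncurry f l) := by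
  have (u : W) : ∃ t : W → W, Involutive t ∧ (u ∉ R → ∀ y, G.Adj u y →
      G.Adj u (t y) ∧ f u (t y) = e (f u y)) := by
    by_cases hu : u ∈ R
    · exact ⟨id, fun _ => rfl, fun h => absurd hu h⟩
    · obtain ⟨t, ht, hmaps, hcol⟩ := exists_involutive_of_bijOn (hf.bijOn u hu) he
      exact ⟨t, ht, fun _ y hy => ⟨hmaps hy, hcol y hy⟩⟩
  choose t ht htu using this
  have hinv : Involutive fun l : W × W => (l.1, t l.1 l.2) := fun l => Prod.ext rfl (ht _ _)
  exact ⟨hinv.toPerm, hinv, fun _ => rfl, fun l hl =>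
    ⟨⟨(htu l.1 hl.2 l.2 hl.1).1, hl.2⟩, (htu l.1 hl.2 l.2 hl.1).2⟩⟩

open Classical in
theorem IsPoleColoring.recolor (hf : IsPoleColoring G R K f) {e : C → C}
    {σ τ : Equiv.Perm (W × W)} (hτ : Involutive τ) (hτ₁ : ∀ l, (τ l).1 = l.1)
    (hτf : ∀ l ∈ halfEdges G R, τ l ∈ halfEdges G R ∧ uncurry f (τ l) = e (uncurry f l))
    (hσ : ∀ u y, G.Adj u y → u ∉ R → y ∉ R → s(u, y) ∉ K → σ (u, y) = (y, u))
    {O : Set (W × W)} (hOσ : Set.MapsTo σ O O) (hOτ : Set.MapsTo τ O O) :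
    IsPoleColoring G R K fun u y => if (u, y) ∈ O then e (f u y) else f u y := by
  have hτ₂ (u y : W) : (u, (τ (u, y)).2) = τ (u, y) := Prod.ext (hτ₁ (u, y)).symm rfl
  refine ⟨fun u hu => ?_, fun u y huy hu hy hK => ?_⟩
  · have hinv : Involutive fun y => if (u, y) ∈ O then (τ (u, y)).2 else y := fun y => by
      by_cases h : (u, y) ∈ O
      · simp only [h, if_true, hτ₂, hOτ h, hτ (u, y)]
      · simp only [h, if_false]
    have hmaps : Set.MapsTo (fun y => if (u, y) ∈ O then (τ (u, y)).2 else y) (G.neighborSet u)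
        (G.neighborSet u) := fun y hy => by
      dsimp only
      split_ifs
      · have h := (hτf (u, y) ⟨hy, hu⟩).1.1
        rwa [hτ₁] at h
      · exact hy
    refine ((hf.bijOn u hu).comp (Set.InvOn.bijOn ⟨fun y _ => hinv y, fun y _ => hinv y⟩
      hmaps hmaps)).congr fun y hy => ?_
    simp only [comp_apply]
    split_ifs
    · have h := (hτf (u, y) ⟨hy, hu⟩).2
      rwa [← hτ₂] at h
    · rfl
  · have hiff : (u, y) ∈ O ↔ (y, u) ∈ O := by
      refine ⟨fun h => ?_, fun h => ?_⟩
      · simpa only [hσ u y huy hu hy hK] using hOσ h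
      · simpa only [hσ y u huy.symm hy hu (by rwa [Sym2.eq_swap])] using hOσ h
    simp only [hiff, hf.symm u y huy hu hy hK]

theorem IsPoleColoring.exists_kempe_pairing [Finite W] (hf : IsPoleColoring G R K f) {e : C → C}
    (he : Involutive e) :
    ∃ π, IsKempePairing {l | IsTerminal G R K l} (uncurry f) e π ∧
      ∀ S, Set.MapsTo π S S → ∃ f' : W → W → C, IsPoleColoring G R K f' ∧
        (∀ u y, f' u y = f u y ∨ f' u y = e (f u y)) ∧
        ∀ l, IsTerminal G R K l → (l ∈ S → uncurry f' l = e (uncurry f l)) ∧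
          (l ∉ S → uncurry f' l = uncurry f l) := by
  classical
  obtain ⟨σ, hσ, hσf, hσfix, hσmate⟩ := hf.exists_mate
  obtain ⟨τ, hτ, hτ₁, hτf⟩ := hf.exists_turn he
  have hterm (l) : IsTerminal G R K l ↔ l ∈ halfEdges G R ∧ σ l = l :=
    ⟨fun h => ⟨⟨h.1, h.2.1⟩, (hσfix l ⟨h.1, h.2.1⟩).2 h⟩, fun h => (hσfix l h.1).1 h.2⟩
  obtain ⟨π, hπ, hO⟩ := exists_isKempePairing hσ hτ he hσf hτf
  refine ⟨π, by simpa only [hterm], fun S hS => ?_⟩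
  obtain ⟨O, hOσ, hOτ, hOS⟩ := hO S hS
  refine ⟨_, hf.recolor hτ hτ₁ hτf hσmate hOσ hOτ, fun u y => ?_, fun l hl => ?_⟩
  · split_ifs
    exacts [Or.inr rfl, Or.inl rfl]
  · change (_ → (if l ∈ O then e (uncurry f l) else uncurry f l) = _) ∧ (_ →
      (if l ∈ O then e (uncurry f l) else uncurry f l) = _)
    by_cases hne : e (uncurry f l) = uncurry f l
    · simp only [hne, ite_self, implies_true, and_self]
    · rw [hOS l ((hterm l).1 hl).1 ((hterm l).1 hl).2 hne]
      exact ⟨fun h => if_pos h, fun h => if_neg h⟩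

theorem IsPoleColoring.exists_pair_swap [Finite W] (hf : IsPoleColoring G R K f) {e : C → C}
    (he : Involutive e) {l : W × W} (hl : IsTerminal G R K l)
    (hne : e (uncurry f l) ≠ uncurry f l) :
    ∃ l', IsTerminal G R K l' ∧ l' ≠ l ∧
      (uncurry f l' = uncurry f l ∨ uncurry f l' = e (uncurry f l)) ∧
      ∃ f' : W → W → C, IsPoleColoring G R K f' ∧ (∀ u y, f' u y = f u y ∨ f' u y = e (f u y)) ∧
        uncurry f' l = e (uncurry f l) ∧ uncurry f' l' = e (uncurry f l') ∧
        ∀ k, IsTerminal G R K k → k ≠ l → k ≠ l' → uncurry f' k = uncurry f k := by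
  obtain ⟨π, hπ, hS⟩ := hf.exists_kempe_pairing he
  obtain ⟨h1, h2, h3, h4⟩ := hπ l hl hne
  obtain ⟨f', hf', h5, h6⟩ := hS {l, π l} (by
    rintro k (rfl | rfl)
    · simp
    · simp [h3])
  exact ⟨π l, h1, h2, h4, f', hf', h5, (h6 l hl).1 (by simp), (h6 _ h1).1 (by simp),
    fun k hk hkl hkl' => (h6 k hk).2 (by simp [hkl, hkl'])⟩

end Pole

section SplitColoring

variable {W C : Type*} {G : SimpleGraph W} {v w z x y : W} {N₁ N₂ : Set W} {f : W → W → C}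

/-- `N₁` and `N₂` partition the neighborhood of `v`; either may be empty. -/
structure IsNeighborPartition (G : SimpleGraph W) (v : W) (N₁ N₂ : Set W) : Prop where
  union_eq : N₁ ∪ N₂ = G.neighborSet v
  disjoint : Disjoint N₁ N₂

namespace IsNeighborPartition

theorem symm (P : IsNeighborPartition G v N₁ N₂) : IsNeighborPartition G v N₂ N₁ :=
  ⟨by rw [Set.union_comm, P.union_eq], P.disjoint.symm⟩

theorem adj_left (P : IsNeighborPartition G v N₁ N₂) (hx : x ∈ N₁) : G.Adj v x := by
  rw [← mem_neighborSet, ← P.union_eq]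
  exact Or.inl hx

theorem adj_right (P : IsNeighborPartition G v N₁ N₂) (hx : x ∈ N₂) : G.Adj v x :=
  P.symm.adj_left hx

theorem mem_or_mem (P : IsNeighborPartition G v N₁ N₂) (hx : G.Adj v x) : x ∈ N₁ ∨ x ∈ N₂ := by
  rwa [← mem_neighborSet, ← P.union_eq] at hx

theorem ne (P : IsNeighborPartition G v N₁ N₂) (hx : x ∈ N₁) (hy : y ∈ N₂) : x ≠ y :=
  P.disjoint.ne_of_mem hx hy

theorem exists_color (P : IsNeighborPartition G v N₁ N₂) (hf : IsPoleColoring G ∅ ∅ f) (c : C) :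
    (∃ y ∈ N₁, f v y = c) ∨ ∃ y ∈ N₂, f v y = c := by
  obtain ⟨y, hy, hc⟩ := (hf.bijOn v (Set.notMem_empty v)).surjOn (Set.mem_univ c)
  exact (P.mem_or_mem hy).imp (fun h => ⟨y, h, hc⟩) fun h => ⟨y, h, hc⟩

end IsNeighborPartition

/-- The edge `wz`, not incident with `v`, is repairable: some coloring of `G` with `v` deleted and
`wz` cut yields a proper coloring of the split graph minus `wz`, where a color `γ` is left for the
edge between the two halves of `v`. -/
def HasSplitColoring (C : Type*) (G : SimpleGraph W) (v : W) (N₁ N₂ : Set W) (w z : W) : Prop :=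
  ∃ (f : W → W → C) (γ : C), IsPoleColoring G {v} {s(w, z)} f ∧
    Set.InjOn (fun y => f y v) N₁ ∧ Set.InjOn (fun y => f y v) N₂ ∧ ∀ y, G.Adj v y → f y v ≠ γ

theorem HasSplitColoring.swap_sides (h : HasSplitColoring C G v N₁ N₂ w z) :
    HasSplitColoring C G v N₂ N₁ w z := by
  obtain ⟨f, γ, hf, h₁, h₂, hγ⟩ := h
  exact ⟨f, γ, hf, h₂, h₁, hγ⟩

theorem HasSplitColoring.swap_ends (h : HasSplitColoring C G v N₁ N₂ w z) :
    HasSplitColoring C G v N₁ N₂ z w := by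
  rwa [HasSplitColoring, Sym2.eq_swap]

-- If `vx` receives the color of an edge `vy` on the other side, both sides stay properly colored
-- and the former color of `vx` becomes free for the new edge.
theorem HasSplitColoring.of_bijOn (P : IsNeighborPartition G v N₁ N₂)
    (hf : IsPoleColoring G {v} {s(w, z)} f) {h : W → C}
    (hh : Set.BijOn h (G.neighborSet v) Set.univ) (hx : x ∈ N₁) (hy : y ∈ N₂) (hfx : f x v = h y)
    (hfh : ∀ u, G.Adj v u → u ≠ x → f u v = h u) : HasSplitColoring C G v N₁ N₂ w z := by
  classical
  let g : W → W := update id x y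
  have hgx : g x = y := update_self x y id
  have hg (u : W) (hu : u ≠ x) : g u = u := update_of_ne hu y id
  have hgadj (u : W) (hu : G.Adj v u) : G.Adj v (g u) := by
    obtain rfl | hux := eq_or_ne u x
    · exact hgx ▸ P.adj_right hy
    · exact (hg u hux).symm ▸ hu
  have hfg (u : W) (hu : G.Adj v u) : f u v = h (g u) := by
    obtain rfl | hux := eq_or_ne u x
    · rw [hgx, hfx]
    · rw [hg u hux, hfh u hu hux]
  have hginj {u u' : W} (hu : G.Adj v u) (hu' : G.Adj v u') (heq : f u v = f u' v) : g u = g u' :=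
    hh.injOn (hgadj u hu) (hgadj u' hu') (by rwa [← hfg u hu, ← hfg u' hu'])
  refine ⟨f, h x, hf, fun u hu u' hu' heq => ?_, fun u hu u' hu' heq => ?_, fun u hu heq => ?_⟩
  · have := hginj (P.adj_left hu) (P.adj_left hu') heq
    grind [P.ne hu hy, P.ne hu' hy]
  · rw [← hg u (P.ne hx hu).symm, ← hg u' (P.ne hx hu').symm]
    exact hginj (P.adj_right hu) (P.adj_right hu') heq
  · have := hh.injOn (hgadj u hu) (P.adj_left hx) ((hfg u hu).symm.trans heq)
    grind [P.ne hx hy]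

theorem IsPoleColoring.comm (hf : IsPoleColoring G ∅ ∅ f) (h : G.Adj x y) : f x y = f y x :=
  hf.symm x y h (Set.notMem_empty x) (Set.notMem_empty y) (Set.notMem_empty _)

theorem IsPoleColoring.eq_of_eq (hf : IsPoleColoring G ∅ ∅ f) (hx : G.Adj v x) (hy : G.Adj v y)
    (h : f v x = f v y) : x = y :=
  (hf.bijOn v (Set.notMem_empty v)).injOn hx hy h

open Classical in
theorem IsPoleColoring.restore_of_eq (hf : IsPoleColoring G ∅ ∅ f) {f' : W → W → C}
    (hf' : IsPoleColoring G {v} {s(w, z)} f') (hwv : w ≠ v) (hzv : z ≠ v)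
    (hv : ∀ u, G.Adj v u → f' u v = f v u) (hwz : f' w z = f' z w) :
    IsPoleColoring G ∅ ∅ (update f' v (f v)) := by
  refine (IsPoleColoring.restore (by rwa [insert_empty_eq]) (hf.bijOn v (Set.notMem_empty v))
    fun u hu _ _ => (hv u hu).symm).glue fun p q hpq => ?_
  rcases Sym2.eq_iff.1 hpq with ⟨rfl, rfl⟩ | ⟨rfl, rfl⟩
  · rw [update_of_ne hwv, update_of_ne hzv, hwz]
  · rw [update_of_ne hwv, update_of_ne hzv, hwz]

open Classical in
theorem IsPoleColoring.exists_chain_switch [Finite W] (hf : IsPoleColoring G ∅ ∅ f) {R : Set W}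
    (hwz : G.Adj w z) (hw : w ∉ R) (hz : z ∉ R) {c : C} (hc : c ≠ f w z) :
    ∃ a b, G.Adj b a ∧ a ∉ R ∧ (b ∈ R ∨ a = z ∧ b = w) ∧ (f b a = f w z ∨ f b a = c) ∧
      ∃ f' : W → W → C, IsPoleColoring G R {s(w, z)} f' ∧
        (∀ u y, f' u y = f u y ∨ f' u y = Equiv.swap (f w z) c (f u y)) ∧
        f' w z = c ∧ f' a b = Equiv.swap (f w z) c (f b a) ∧
        ∀ u, ∀ r ∈ R, u ∉ R → G.Adj r u → (u, r) ≠ (a, b) → f' u r = f r u := by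
  have hpole : IsPoleColoring G R {s(w, z)} f :=
    hf.mono (Set.empty_subset _) fun _ _ h => absurd h (Set.notMem_empty _)
  obtain ⟨⟨a, b⟩, ⟨hab, ha, hb⟩, hab_ne, hcol, f', hf', hff', hfw, hfa, hfo⟩ :=
    hpole.exists_pair_swap (Equiv.swap_apply_self (f w z) c) (l := (w, z))
      ⟨hwz, hw, Or.inr rfl⟩ (by simpa using hc)
  simp only [uncurry_apply_pair, Equiv.swap_apply_left, hf.comm hab] at hcol hfw hfa
  refine ⟨a, b, hab.symm, ha, hb.imp_right fun hb => ?_, hcol, f', hf', hff', hfw, hfa,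
    fun u r hr hu hru hne => ?_⟩
  · rcases Sym2.eq_iff.1 hb with h | h
    exacts [absurd (Prod.ext h.1 h.2) hab_ne, h]
  · have hne' : (u, r) ≠ (w, z) := by
      rintro ⟨rfl, rfl⟩
      exact hz hr
    exact (hfo (u, r) ⟨hru.symm, hu, Or.inl hr⟩ hne' hne).trans (hf.comm hru.symm)

-- The chain that starts at the cut of `wz` either ends at `v`, which repairs `wz`, or at the other
-- half of `wz`, in which case it is an alternating cycle of `G` through `wz` avoiding `v`.
open Classical in
theorem exists_switch [Finite W] (P : IsNeighborPartition G v N₁ N₂) (hwz : G.Adj w z)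
    (hwv : w ≠ v) (hzv : z ≠ v) (hbad : ¬ HasSplitColoring C G v N₁ N₂ w z)
    (hf : IsPoleColoring G ∅ ∅ f) (hx : x ∈ N₁) (hy : y ∈ N₂) (hfx : f v x = f w z) :
    ∃ f' : W → W → C, IsPoleColoring G ∅ ∅ f' ∧ (∀ u, G.Adj v u → f' v u = f v u) ∧
      ∀ u, G.Adj w u → f' w u = Equiv.swap (f w z) (f v y) (f w u) := by
  have hvx := P.adj_left hx
  have hvy := P.adj_right hy
  have hrow := hf.bijOn v (Set.notMem_empty v)
  have hne : f v y ≠ f w z := fun h => P.ne hx hy (hf.eq_of_eq hvx hvy (hfx.trans h.symm))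
  obtain ⟨a, b, hba, -, hb, hcol, f', hf', hff', hfw, hfa, hfo⟩ :=
    hf.exists_chain_switch (R := {v}) hwz hwv hzv hne
  have hkeep (u : W) (hu : G.Adj v u) (hua : (u, v) ≠ (a, b)) : f' u v = f v u :=
    hfo u v rfl hu.ne' hu hua
  rcases hb with rfl | ⟨rfl, rfl⟩
  · refine absurd ?_ hbad
    rcases hcol with h | h <;> rw [h] at hfa
    · obtain rfl := hf.eq_of_eq hba hvx (h.trans hfx.symm)
      exact .of_bijOn P hf' hrow hx hy (by rw [hfa, Equiv.swap_apply_left])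
        fun u hu hua => hkeep u hu (by simpa)
    · obtain rfl := hf.eq_of_eq hba hvy h
      exact (HasSplitColoring.of_bijOn P.symm hf' hrow hy hx
        (by rw [hfa, Equiv.swap_apply_right, hfx]) fun u hu hua => hkeep u hu (by simpa)).swap_sides
  · rw [Equiv.swap_apply_left] at hfa
    have hfull := hf.restore_of_eq hf' hwv hzv (fun u hu => hkeep u hu (by simp [hwv.symm]))
      (hfw.trans hfa.symm)
    refine ⟨_, hfull, fun _ _ => by rw [update_self], fun u hu => ?_⟩
    have hinj : f' b u = f' b a → u = a := by
      simpa only [update_of_ne hwv] using hfull.eq_of_eq hu hwz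
    rw [update_of_ne hwv]
    obtain rfl | hua := eq_or_ne u a
    · rw [hfw, Equiv.swap_apply_left]
    · rcases hff' b u with h | h
      · rw [h, Equiv.swap_apply_of_ne_of_ne (mt (hf.eq_of_eq hu hwz) hua)]
        rw [← h, ← hfw]
        exact mt hinj hua
      · exact h

theorem exists_color_mem_right [Finite W] (P : IsNeighborPartition G v N₁ N₂) (hN₂ : N₂.Nonempty)
    (hwz : G.Adj w z) (hwv : w ≠ v) (hzv : z ≠ v) (hbad : ¬ HasSplitColoring C G v N₁ N₂ w z)
    (hf : IsPoleColoring G ∅ ∅ f) (hwx : G.Adj w x) (hxz : x ≠ z) :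
    ∃ f' : W → W → C, IsPoleColoring G ∅ ∅ f' ∧ ∃ y ∈ N₂, f' v y = f' w x := by
  classical
  have swap_color {f : W → W → C} (hf : IsPoleColoring G ∅ ∅ f) {y y' : W} (hy : y ∈ N₁)
      (hy' : y' ∈ N₂) (hyx : f v y = f w x) (hyz : f v y' = f w z) :
      ∃ f' : W → W → C, IsPoleColoring G ∅ ∅ f' ∧ ∃ y ∈ N₂, f' v y = f' w x := by
    obtain ⟨f', hf', hv, hw⟩ :=
      exists_switch P.symm hwz hwv hzv (fun h => hbad h.swap_sides) hf hy' hy hyz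
    exact ⟨f', hf', y', hy', by
      rw [hv y' (P.adj_right hy'), hw x hwx, ← hyx, Equiv.swap_apply_right, hyz]⟩
  rcases P.exists_color hf (f w x) with ⟨u, hu, hux⟩ | hright
  swap
  · exact ⟨f, hf, hright⟩
  rcases P.exists_color hf (f w z) with ⟨y, hy, hyz⟩ | ⟨y', hy', hyz⟩
  · obtain ⟨y', hy'⟩ := hN₂
    obtain ⟨f', hf', hv, hw⟩ := exists_switch P hwz hwv hzv hbad hf hy hy' hyz
    refine swap_color hf' hu hy' ?_ ?_
    · rw [hv u (P.adj_left hu), hw x hwx, hux, Equiv.swap_apply_of_ne_of_ne]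
      · exact fun h => hxz (hf.eq_of_eq hwx hwz h)
      · exact fun h => P.ne hu hy'
          (hf.eq_of_eq (P.adj_left hu) (P.adj_right hy') (hux.trans h))
    · rw [hv y' (P.adj_right hy'), hw z hwz, Equiv.swap_apply_left]
  · exact swap_color hf hu hy' hux hyz

theorem hasSplitColoring_of_mem_left [Finite W] (P : IsNeighborPartition G v N₁ N₂)
    (hN₂ : N₂.Nonempty) (hf : IsPoleColoring G ∅ ∅ f) (hw : w ∈ N₁) (hwz : G.Adj w z)
    (hzv : z ≠ v) : HasSplitColoring C G v N₁ N₂ w z := by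
  classical
  have hvw := P.adj_left hw
  have of_color {f : W → W → C} (hf : IsPoleColoring G ∅ ∅ f) {y : W} (hy : y ∈ N₂)
      (hyz : f v y = f w z) : HasSplitColoring C G v N₁ N₂ w z := by
    have hpole : IsPoleColoring G {v} {s(w, z)} f :=
      hf.mono (Set.empty_subset _) fun _ _ h => absurd h (Set.notMem_empty _)
    refine .of_bijOn P (hpole.exchange (u := w) (y₁ := v) (y₂ := z)
      ⟨hvw.symm, hvw.ne', Or.inl rfl⟩ ⟨hwz, hvw.ne', Or.inr rfl⟩)
      (hf.bijOn v (Set.notMem_empty v)) hw hy ?_ fun u hu huw => ?_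
    · rw [update_self, Equiv.swap_apply_left, hyz]
    · rw [update_of_ne huw, hf.comm hu]
  rcases P.exists_color hf (f w z) with ⟨x, hx, hxz⟩ | ⟨y, hy, hyz⟩
  · obtain ⟨y, hy⟩ := hN₂
    by_contra hbad
    obtain ⟨f', hf', hv, hw⟩ := exists_switch P hwz hvw.ne' hzv hbad hf hx hy hxz
    exact hbad (of_color hf' hy
      (by rw [hv y (P.adj_right hy), hw z hwz, Equiv.swap_apply_left]))
  · exact of_color hf hy hyz

theorem HasSplitColoring.of_restore (P : IsNeighborPartition G v N₁ N₂)
    (hf : IsPoleColoring G {x, v} {s(w, z)} f) {r h : W → C}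
    (hr : Set.BijOn r (G.neighborSet x) Set.univ) (hrf : ∀ u, G.Adj x u → u ≠ v → r u = f u x)
    (hh : Set.BijOn h (G.neighborSet v) Set.univ) (hhf : ∀ u, G.Adj v u → u ≠ x → f u v = h u)
    (hx : x ∈ N₁) (hy : y ∈ N₂) (hry : r v = h y) : HasSplitColoring C G v N₁ N₂ w z := by
  classical
  exact .of_bijOn P (hf.restore hr fun u hu huv _ => hrf u hu huv) hh hx hy
    (by rw [update_self, hry]) fun u hu hux => by rw [update_of_ne hux, hhf u hu hux]

-- Exchanging the half-edges `wz` and `wx` at `w`, and `xv` and `xw` at `x`, gives `vx` the color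
-- `f₀ w x` of the edge `vy`.
theorem HasSplitColoring.of_exchange (P : IsNeighborPartition G v N₁ N₂) {f₀ : W → W → C}
    (hf₀ : IsPoleColoring G ∅ ∅ f₀) (hf : IsPoleColoring G {x, v} {s(w, z)} f) {h : W → C}
    (hwz : G.Adj w z) (hwx : G.Adj w x) (hwv : w ≠ v) (hzv : z ≠ v) (hfw : f w z = f₀ x v)
    (hfx : ∀ u, G.Adj x u → u ≠ v → f u x = f₀ u x)
    (hh : Set.BijOn h (G.neighborSet v) Set.univ) (hhf : ∀ u, G.Adj v u → u ≠ x → f u v = h u)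
    (hx : x ∈ N₁) (hy : y ∈ N₂) (hhy : h y = f₀ w x) : HasSplitColoring C G v N₁ N₂ w z := by
  classical
  have hvx := P.adj_left hx
  have hw : w ∉ ({x, v} : Set W) := by simp [hwx.ne, hwv]
  refine .of_restore P
    (hf.exchange (u := w) (y₁ := z) (y₂ := x) ⟨hwz, hw, Or.inr rfl⟩ ⟨hwx, hw, Or.inl (Or.inl rfl)⟩)
    (bijOn_comp_swap (hf₀.bijOn x (Set.notMem_empty x)) hvx.symm hwx.symm) (fun u hu huv => ?_)
    hh (fun u hu hux => ?_) hx hy ?_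
  · obtain rfl | huw := eq_or_ne u w
    · rw [update_self, Equiv.swap_apply_right, Equiv.swap_apply_right, hfw]
    · rw [update_of_ne huw, Equiv.swap_apply_of_ne_of_ne huv huw, hfx u hu huv, hf₀.comm hu]
  · obtain rfl | huw := eq_or_ne u w
    · rw [update_self, Equiv.swap_apply_of_ne_of_ne hzv.symm hvx.ne, hhf u hu hux]
    · rw [update_of_ne huw, hhf u hu hux]
  · rw [Equiv.swap_apply_left, hhy, hf₀.comm hwx]

-- Delete `x` and `v`, cut `wz`, and follow the chain from the cut in the colors of `wz` and `vx`:
-- wherever it ends, switching it makes `wz` repairable.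
theorem hasSplitColoring_of_colors [Finite W] (P : IsNeighborPartition G v N₁ N₂)
    (hwz : G.Adj w z) (hwv : w ≠ v) (hzv : z ≠ v) (hf : IsPoleColoring G ∅ ∅ f) (hx : x ∈ N₁)
    (hwx : G.Adj w x) (hxz : x ≠ z) {y₁ y₂ : W} (hy₁ : y₁ ∈ N₂) (hy₂ : y₂ ∈ N₂)
    (hc₁ : f v y₁ = f w x) (hc₂ : f v y₂ = f w z) : HasSplitColoring C G v N₁ N₂ w z := by
  classical
  have hvx := P.adj_left hx
  have hvy₂ := P.adj_right hy₂
  have hrow := hf.bijOn v (Set.notMem_empty v)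
  have hne : f x v ≠ f w z := fun h =>
    P.ne hx hy₂ (hf.eq_of_eq hvx hvy₂ ((hf.comm hvx).trans (h.trans hc₂.symm)))
  have hy₁₂ : y₁ ≠ y₂ := by
    rintro rfl
    exact hxz (hf.eq_of_eq hwx hwz (hc₁.symm.trans hc₂))
  obtain ⟨a, b, hba, ha, hb, hcol, f', hf', -, hfw, hfa, hfo⟩ :=
    hf.exists_chain_switch (R := {x, v}) hwz (by simp [hwx.ne, hwv]) (by simp [hxz.symm, hzv]) hne
  have hkeep_v (u : W) (hu : G.Adj v u) (hux : u ≠ x) : (u, v) ≠ (a, b) → f' u v = f v u :=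
    hfo u v (by simp) (by simp [hux, hu.ne']) hu
  have hkeep_x (u : W) (hu : G.Adj x u) (huv : u ≠ v) (hua : (u, x) ≠ (a, b)) : f' u x = f u x :=
    (hfo u x (by simp) (by simp [huv, hu.ne']) hu hua).trans (hf.comm hu)
  simp only [Set.mem_insert_iff, Set.mem_singleton_iff, not_or] at ha hb
  rcases hb with (rfl | rfl) | ⟨rfl, rfl⟩
  · replace hcol := hcol.resolve_right fun h => ha.2 (hf.eq_of_eq hba hvx.symm h)
    rw [hcol, Equiv.swap_apply_left] at hfa
    refine .of_restore P hf' (bijOn_comp_swap (hf.bijOn b (Set.notMem_empty b)) hvx.symm hba)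
      (fun u hu huv => ?_) hrow (fun u hu hux => hkeep_v u hu hux (by simp [hvx.ne])) hx hy₂
      (by rw [Equiv.swap_apply_left, hcol, hc₂])
    obtain rfl | hua := eq_or_ne u a
    · rw [Equiv.swap_apply_right, hfa]
    · rw [Equiv.swap_apply_of_ne_of_ne huv hua, hkeep_x u hu huv (by simp [hua]), hf.comm hu]
  · replace hcol := hcol.resolve_right fun h =>
      ha.1 (hf.eq_of_eq hba hvx (h.trans (hf.comm hvx.symm)))
    obtain rfl := hf.eq_of_eq hba hvy₂ (hcol.trans hc₂.symm)
    rw [hcol, Equiv.swap_apply_left] at hfa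
    refine .of_exchange P hf hf' hwz hwx hwv hzv hfw
      (fun u hu huv => hkeep_x u hu huv (by simp [hvx.ne'])) (bijOn_comp_swap hrow hvx hba)
      (fun u hu hux => ?_) hx hy₁
      (by rw [Equiv.swap_apply_of_ne_of_ne (P.ne hx hy₁).symm hy₁₂, hc₁])
    obtain rfl | hua := eq_or_ne u a
    · rw [Equiv.swap_apply_right, hfa, hf.comm hvx]
    · rw [Equiv.swap_apply_of_ne_of_ne hux hua, hkeep_v u hu hux (by simp [hua])]
  · exact .of_exchange P hf hf' hwz hwx hwv hzv hfw
      (fun u hu huv => hkeep_x u hu huv (by simp [hwx.ne'])) hrow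
      (fun u hu hux => hkeep_v u hu hux (by simp [hwv.symm])) hx hy₁ hc₁

theorem hasSplitColoring_of_nontrivial [Finite W] (P : IsNeighborPartition G v N₁ N₂)
    (hN₂ : N₂.Nontrivial) (hwz : G.Adj w z) (hwv : w ≠ v) (hzv : z ≠ v)
    (hf : IsPoleColoring G ∅ ∅ f) (hx : x ∈ N₁) (hwx : G.Adj w x) (hxz : x ≠ z) :
    HasSplitColoring C G v N₁ N₂ w z := by
  classical
  by_contra hbad
  obtain ⟨f, hf, y, hy, hyx⟩ :=
    exists_color_mem_right P hN₂.nonempty hwz hwv hzv hbad hf hwx hxz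
  rcases P.exists_color hf (f w z) with ⟨t, ht, htz⟩ | ⟨y', hy', hyz⟩
  · obtain ⟨y', hy', hne⟩ := hN₂.exists_ne y
    have hvy := P.adj_right hy
    have hvy' := P.adj_right hy'
    obtain ⟨f', hf', hv, hw⟩ := exists_switch P hwz hwv hzv hbad hf ht hy' htz
    refine hbad (hasSplitColoring_of_colors P hwz hwv hzv hf' hx hwx hxz hy hy' ?_ ?_)
    · rw [hv y hvy, hw x hwx, hyx, Equiv.swap_apply_of_ne_of_ne]
      · exact fun h => hxz (hf.eq_of_eq hwx hwz h)
      · exact fun h => hne (hf.eq_of_eq hvy' hvy (h.symm.trans hyx.symm))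
    · rw [hv y' hvy', hw z hwz, Equiv.swap_apply_left]
  · exact hbad (hasSplitColoring_of_colors P hwz hwv hzv hf hx hwx hxz hy hy' hyx hyz)

end SplitColoring

section KempeClosed

variable {ι κ : Type*} [DecidableEq ι]

/-- A set of boundary colorings closed under Kempe changes: once the ends `ι` of the alternating
chains are paired up, any union of pairs may be recolored. -/
def KempeClosed (B : Set (ι → κ)) : Prop :=
  ∀ μ ∈ B, ∀ e : κ → κ, Involutive e → ∃ π, IsKempePairing Set.univ μ e π ∧
    ∀ S : Finset ι, Set.MapsTo π S S → S.piecewise (e ∘ μ) μ ∈ B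

theorem KempeClosed.exists_pairs {B : Set (ι → κ)} (hB : KempeClosed B) {μ : ι → κ} (hμ : μ ∈ B)
    {e : κ → κ} (he : Involutive e) {i j : ι} (hi : e (μ i) ≠ μ i) (hj : e (μ j) ≠ μ j) :
    ∃ i' j', (i' ≠ i ∧ (μ i' = μ i ∨ μ i' = e (μ i))) ∧ (j' ≠ j ∧ (μ j' = μ j ∨ μ j' = e (μ j))) ∧
      Finset.piecewise {i, i'} (e ∘ μ) μ ∈ B ∧ Finset.piecewise {j, j'} (e ∘ μ) μ ∈ B ∧
      Finset.piecewise {i, i', j, j'} (e ∘ μ) μ ∈ B := by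
  obtain ⟨π, hπ, hS⟩ := hB μ hμ e he
  obtain ⟨-, hi₁, hi₂, hi₃⟩ := hπ i (Set.mem_univ i) hi
  obtain ⟨-, hj₁, hj₂, hj₃⟩ := hπ j (Set.mem_univ j) hj
  refine ⟨π i, π j, ⟨hi₁, hi₃⟩, ⟨hj₁, hj₃⟩, hS _ ?_, hS _ ?_, hS _ ?_⟩ <;>
    simp +contextual [Set.MapsTo, or_imp, hi₂, hj₂]

theorem KempeClosed.exists_pair {B : Set (ι → κ)} (hB : KempeClosed B) {μ : ι → κ} (hμ : μ ∈ B)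
    {e : κ → κ} (he : Involutive e) {i : ι} (hi : e (μ i) ≠ μ i) :
    ∃ i', (i' ≠ i ∧ (μ i' = μ i ∨ μ i' = e (μ i))) ∧ Finset.piecewise {i, i'} (e ∘ μ) μ ∈ B := by
  obtain ⟨i', -, hi', -, hB', -⟩ := hB.exists_pairs hμ he hi hi
  exact ⟨i', hi', hB'⟩

/-- The terminals `0`, `1` differ in color and `4`, `5`, `6`, `7`, which end at the same deleted
vertex, have distinct colors. -/
abbrev IsGoodBoundary (μ : Fin 8 → Fin 4) : Prop :=
  μ 0 ≠ μ 1 ∧ ∀ i j, 4 ≤ i → 4 ≤ j → μ i = μ j → i = j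

-- Exchange the colors `0 ↔ 2` and `1 ↔ 3` along the chain from `6`. If it ends at `0` or `1`, the
-- colors there become different and only `6` and `7` are left to be corrected; if it ends at `5`,
-- the chain from `7` has to be considered as well.
theorem exists_isGoodBoundary {B : Set (Fin 8 → Fin 4)} (hB : KempeClosed B)
    (hv : ∀ μ ∈ B, μ ∘ Equiv.swap 1 4 ∈ B) (hw : ∀ μ ∈ B, μ ∘ Equiv.swap 2 5 ∈ B)
    (hz : ∀ μ ∈ B, μ ∘ Equiv.swap 3 6 ∈ B) (hμ : ![0, 0, 3, 3, 1, 2, 0, 3] ∈ B) :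
    ∃ μ ∈ B, IsGoodBoundary μ := by
  obtain ⟨i, j, hi, hj, hBi, hBj, hBij⟩ := hB.exists_pairs hμ (e := ![2, 3, 0, 1])
    (by unfold Involutive; decide) (i := 6) (j := 7) (by decide) (by decide)
  have hi' : i = 0 ∨ i = 1 ∨ i = 5 := by
    clear hBi hBij
    decide +revert
  have hj' : j = 2 ∨ j = 3 ∨ j = 4 := by
    clear hBj hBij
    decide +revert
  rcases hi' with rfl | rfl | rfl
  · obtain ⟨k, hk, hBk⟩ := hB.exists_pair hBi (e := Equiv.swap 0 3)
      (by unfold Involutive; decide) (i := 7) (by decide)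
    have hk' : k = 1 ∨ k = 2 ∨ k = 3 := by
      clear hBk
      decide +revert
    rcases hk' with rfl | rfl | rfl
    exacts [⟨_, hw _ hBk, by decide⟩, ⟨_, hz _ hBk, by decide⟩, ⟨_, hw _ hBk, by decide⟩]
  · obtain ⟨k, hk, hBk⟩ := hB.exists_pair hBi (e := Equiv.swap 0 3)
      (by unfold Involutive; decide) (i := 7) (by decide)
    have hk' : k = 0 ∨ k = 2 ∨ k = 3 := by
      clear hBk
      decide +revert
    rcases hk' with rfl | rfl | rfl
    exacts [⟨_, hw _ hBk, by decide⟩, ⟨_, hz _ hBk, by decide⟩, ⟨_, hw _ hBk, by decide⟩]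
  · rcases hj' with rfl | rfl | rfl
    exacts [⟨_, hz _ (hv _ hBj), by decide⟩, ⟨_, hw _ (hv _ hBij), by decide⟩,
      ⟨_, hz _ (hv _ hBj), by decide⟩]

end KempeClosed

section Boundary

variable {ι κ C D : Type*}

theorem IsKempePairing.exists_comap {T : Set D} {M : D → C} {E : C → C} {π : D → D}
    (hπ : IsKempePairing T M E π) {t : ι → D} {col : κ → C} {μ : ι → κ} {e : κ → κ}
    (he : Involutive e) (ht : Injective t) (hcol : Injective col) (htT : ∀ k, t k ∈ T)
    (hM : ∀ k, M (t k) = col (μ k)) (hE : ∀ j, E (col j) = col (e j))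
    (hout : ∀ l ∈ T, l ∉ Set.range t → M l ∉ Set.range col) :
    ∃ p, IsKempePairing Set.univ μ e p ∧ ∀ k, e (μ k) ≠ μ k → t (p k) = π (t k) := by
  have hmoved (k) (hk : e (μ k) ≠ μ k) : E (M (t k)) ≠ M (t k) := by
    rw [hM, hE]
    exact hcol.ne hk
  have hrange (k) (hk : e (μ k) ≠ μ k) : ∃ k', t k' = π (t k) := by
    obtain ⟨hT, -, -, hc⟩ := hπ _ (htT k) (hmoved k hk)
    by_contra hn
    refine hout _ hT hn ?_
    rw [hM, hE] at hc
    rcases hc with hc | hc <;> rw [hc] <;> exact ⟨_, rfl⟩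
  choose! p hp using hrange
  refine ⟨p, fun k _ hk => ?_, hp⟩
  obtain ⟨-, hne, hinv, hc⟩ := hπ _ (htT k) (hmoved k hk)
  rw [← hp k hk] at hne hinv hc
  rw [hM, hM, hE, hcol.eq_iff, hcol.eq_iff] at hc
  have hk' : e (μ (p k)) ≠ μ (p k) := by
    rcases hc with hc | hc <;> rw [hc]
    · exact hk
    · rw [he]
      exact hk.symm
  exact ⟨Set.mem_univ _, fun h => hne (congrArg t h), ht ((hp _ hk').trans hinv), hc⟩

variable {W : Type*} {G : SimpleGraph W} {R : Set W} {K : Set (Sym2 W)} {f : W → W → C}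
  {t : ι → W × W} {col : κ → C} {μ : ι → κ}

/-- Names `t` for some terminals of a pole coloring `f` and names `col` for some colors, such that
none of the named colors occurs at an unnamed terminal. -/
structure IsBoundaryChart (G : SimpleGraph W) (R : Set W) (K : Set (Sym2 W)) (f : W → W → C)
    (t : ι → W × W) (col : κ → C) : Prop where
  terminal_injective : Injective t
  color_injective : Injective col
  isTerminal (k : ι) : IsTerminal G R K (t k)
  color_notMem (l : W × W) : IsTerminal G R K l → l ∉ Set.range t → uncurry f l ∉ Set.range col

/-- `g` is a pole coloring with colors `μ` at the named terminals that agrees with `f` at the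
unnamed ones. -/
structure Realizes (G : SimpleGraph W) (R : Set W) (K : Set (Sym2 W)) (f : W → W → C)
    (t : ι → W × W) (col : κ → C) (g : W → W → C) (μ : ι → κ) : Prop where
  isPoleColoring : IsPoleColoring G R K g
  named (k : ι) : uncurry g (t k) = col (μ k)
  unnamed (l : W × W) : IsTerminal G R K l → l ∉ Set.range t → uncurry g l = uncurry f l

theorem IsBoundaryChart.kempeClosed [DecidableEq ι] [Finite W]
    (hc : IsBoundaryChart G R K f t col) :
    KempeClosed {μ | ∃ g, Realizes G R K f t col g μ} := by
  rintro μ ⟨g, hg, hgt, hgf⟩ e he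
  obtain ⟨ht, hcol, htT, hout⟩ := hc
  set E : C → C := extend col (col ∘ e) id
  have hE (j : κ) : E (col j) = col (e j) := hcol.extend_apply _ _ j
  have hEinv : Involutive E := fun c => by
    by_cases h : ∃ j, col j = c
    · obtain ⟨j, rfl⟩ := h
      rw [hE, hE, he]
    · have hc : E c = c := extend_apply' _ _ _ h
      rw [hc, hc]
  obtain ⟨π, hπ, hS⟩ := hg.exists_kempe_pairing hEinv
  obtain ⟨p, hp, hpπ⟩ := hπ.exists_comap he ht hcol htT hgt hE fun l hl hlt => by
    rw [hgf l hl hlt]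
    exact hout l hl hlt
  refine ⟨p, hp, fun S hSp => ?_⟩
  have hmem (k : ι) : t k ∈ t '' {k | k ∈ S ∧ e (μ k) ≠ μ k} ↔ k ∈ S ∧ e (μ k) ≠ μ k :=
    ht.mem_set_image
  obtain ⟨g', hg', -, hcolor⟩ := hS (t '' {k | k ∈ S ∧ e (μ k) ≠ μ k}) (by
    rintro _ ⟨k, ⟨hkS, hk⟩, rfl⟩
    obtain ⟨-, -, -, hc⟩ := hp k (Set.mem_univ k) hk
    refine ⟨p k, ⟨hSp hkS, ?_⟩, hpπ k hk⟩
    rcases hc with hc | hc <;> rw [hc]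
    · exact hk
    · rw [he]
      exact hk.symm)
  refine ⟨g', hg', fun k => ?_, fun l hl hlt => ?_⟩
  · by_cases hk : k ∈ S ∧ e (μ k) ≠ μ k
    · rw [(hcolor _ (htT k)).1 ((hmem k).2 hk), hgt, hE, Finset.piecewise_eq_of_mem _ _ _ hk.1,
        comp_apply]
    · rw [(hcolor _ (htT k)).2 (mt (hmem k).1 hk), hgt, Finset.piecewise]
      split_ifs with hkS
      · rw [comp_apply, not_not.1 fun h => hk ⟨hkS, h⟩]
      · rfl
  · rw [(hcolor l hl).2 fun ⟨k, _, hkl⟩ => hlt ⟨k, hkl⟩, hgf l hl hlt]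

open Classical in
theorem Realizes.comp_swap [DecidableEq ι] {g : W → W → C} (hg : Realizes G R K f t col g μ)
    (hc : IsBoundaryChart G R K f t col) {j k : ι} (hjk : (t j).1 = (t k).1) :
    ∃ g', Realizes G R K f t col g' (μ ∘ Equiv.swap j k) := by
  have hj : IsTerminal G R K ((t j).1, (t j).2) := hc.isTerminal j
  have hk : IsTerminal G R K ((t j).1, (t k).2) := hjk ▸ hc.isTerminal k
  have hswap (l : W × W) (hlj : l ≠ t j) (hlk : l ≠ t k) :
      uncurry (update g (t j).1 fun y => g (t j).1 (Equiv.swap (t j).2 (t k).2 y)) l =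
        uncurry g l := by
    by_cases h : l.1 = (t j).1
    · simp only [uncurry, h, update_self]
      rw [Equiv.swap_apply_of_ne_of_ne (fun h' => hlj (Prod.ext h h'))
        fun h' => hlk (Prod.ext (h.trans hjk) h')]
    · simp only [uncurry, update_of_ne h]
  refine ⟨_, hg.isPoleColoring.exchange hj hk, fun l => ?_, fun l hl hlt => ?_⟩
  · obtain rfl | hlj := eq_or_ne l j
    · rw [comp_apply, Equiv.swap_apply_left, ← hg.named, uncurry, update_self,
        Equiv.swap_apply_left, hjk, uncurry]
    · obtain rfl | hlk := eq_or_ne l k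
      · rw [comp_apply, Equiv.swap_apply_right, ← hg.named, uncurry, ← hjk, update_self,
          Equiv.swap_apply_right, uncurry]
      · rw [comp_apply, Equiv.swap_apply_of_ne_of_ne hlj hlk, ← hg.named]
        exact hswap _ (hc.terminal_injective.ne hlj) (hc.terminal_injective.ne hlk)
  · rw [hswap l (fun h => hlt ⟨j, h.symm⟩) fun h => hlt ⟨k, h.symm⟩, hg.unnamed l hl hlt]

theorem Realizes.injOn {g : W → W → C} (hg : Realizes G R K f t col g μ)
    (hc : IsBoundaryChart G R K f t col) {A : Set (W × W)} (hA : ∀ l ∈ A, IsTerminal G R K l)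
    (hf : Set.InjOn (uncurry f) A) (hμ : Set.InjOn μ (t ⁻¹' A)) : Set.InjOn (uncurry g) A := by
  intro l hl l' hl' h
  by_cases hlt : l ∈ Set.range t <;> by_cases hlt' : l' ∈ Set.range t
  · obtain ⟨k, rfl⟩ := hlt
    obtain ⟨k', rfl⟩ := hlt'
    rw [hg.named, hg.named] at h
    rw [hμ hl hl' (hc.color_injective h)]
  · obtain ⟨k, rfl⟩ := hlt
    rw [hg.named, hg.unnamed l' (hA l' hl') hlt'] at h
    exact absurd ⟨_, h⟩ (hc.color_notMem l' (hA l' hl') hlt')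
  · obtain ⟨k, rfl⟩ := hlt'
    rw [hg.named, hg.unnamed l (hA l hl) hlt] at h
    exact absurd ⟨_, h.symm⟩ (hc.color_notMem l (hA l hl) hlt)
  · rw [hg.unnamed l (hA l hl) hlt, hg.unnamed l' (hA l' hl') hlt'] at h
    exact hf hl hl' h

end Boundary

section Triangle

variable {W C : Type*} {G : SimpleGraph W} {v w z x y s : W} {N₁ : Set W} {f : W → W → C}

theorem bijOn_univ_of_injOn [Finite C] {A : Set W} {h₀ h : W → C}
    (h₀A : Set.BijOn h₀ A Set.univ) (hA : Set.InjOn h A) : Set.BijOn h A Set.univ := by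
  refine ⟨Set.mapsTo_univ _ _, hA, ?_⟩
  choose r hrA hr using fun c => h₀A.surjOn (Set.mem_univ c)
  have hinj : Injective (h ∘ r) := fun c c' hc => by
    rw [← hr c, ← hr c', hA (hrA c) (hrA c') hc]
  exact fun c _ => (Finite.surjective_of_injective hinj c).imp' r fun c' hc' => ⟨hrA c', hc'⟩

-- With `N₂ = {s}` the second half of `v` subdivides `vs`, so that `vs` may have different colors at
-- its two ends.
theorem HasSplitColoring.of_cut (P : IsNeighborPartition G v N₁ {s}) (hwv : w ≠ v) (hzv : z ≠ v)
    (hx : x ∈ N₁) (hf : IsPoleColoring G {x} {s(v, s), s(w, z)} f)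
    (hrow : Set.BijOn (fun u => f u x) (G.neighborSet x) Set.univ) (hne : f s v ≠ f v s) :
    HasSplitColoring C G v N₁ {s} w z := by
  classical
  have hvs : G.Adj v s := P.adj_right rfl
  have hvx := P.adj_left hx
  have hv := hf.bijOn v hvx.ne
  have hpole : IsPoleColoring G {v} {s(w, z)} (update f x fun u => f u x) :=
    (IsPoleColoring.restore (R := ∅) (by rwa [insert_empty_eq]) hrow fun _ _ _ _ => rfl).mono
      (Set.empty_subset _) fun a b hab => by
        rcases hab with h | h
        · rcases Sym2.eq_iff.1 h with h | h <;> simp [h.1, h.2]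
        · exact Or.inl h
  have hval (u : W) (hu : u ∈ N₁) : update f x (fun u => f u x) u v = f v u := by
    obtain rfl | hux := eq_or_ne u x
    · rw [update_self]
    · rw [update_of_ne hux]
      refine hf.symm u v (P.adj_left hu).symm hux hvx.ne ?_
      have := P.ne hu rfl
      have := (P.adj_left hu).ne
      simp only [Set.mem_insert_iff, Set.mem_singleton_iff, Sym2.eq_iff]
      grind
  refine ⟨_, f v s, hpole, fun u hu u' hu' h => ?_, Set.injOn_singleton _ _, fun u hu => ?_⟩
  · simp only [hval u hu, hval u' hu'] at h
    exact hv.injOn (P.adj_left hu) (P.adj_left hu') h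
  · rcases P.mem_or_mem hu with hu₁ | rfl
    · rw [hval u hu₁]
      exact fun h => P.ne hu₁ rfl (hv.injOn hu hvs h)
    · rwa [update_of_ne (P.ne hx rfl).symm]

/-- A coloring `f` around a triangle `wzx`, where `x` is a neighbor of `v`, the edges `vs` and `zx`
have the same color and the edge `xy` has the color of `wz`. -/
structure IsTriangleConfiguration (G : SimpleGraph W) (f : W → W → C) (v s w z x y : W) :
    Prop where
  isPoleColoring : IsPoleColoring G ∅ ∅ f
  adj_vs : G.Adj v s
  adj_vx : G.Adj v x
  adj_wz : G.Adj w z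
  adj_wx : G.Adj w x
  adj_zx : G.Adj z x
  adj_xy : G.Adj x y
  w_ne_v : w ≠ v
  z_ne_v : z ≠ v
  x_ne_s : x ≠ s
  color_vs : f v s = f x z
  color_xy : f x y = f w z

/-- The half-edges that remain of `vs`, `wz` and the edges from `x` to `v`, `w`, `z`, `y` when `vs`
and `wz` are cut and `x` is deleted. -/
def triangleTerminals (v s w z x y : W) : Fin 8 → W × W :=
  ![(s, v), (v, s), (w, z), (z, w), (v, x), (w, x), (z, x), (y, x)]

/-- The neighbors of `x` indexed by the colors of their edges to `x`. -/
def triangleCorners (v w z y : W) : Fin 4 → W :=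
  ![z, v, w, y]

namespace IsTriangleConfiguration

theorem isPoleColoring_cut (T : IsTriangleConfiguration G f v s w z x y) :
    IsPoleColoring G {x} {s(v, s), s(w, z)} f :=
  T.isPoleColoring.mono (Set.empty_subset _) fun _ _ h => absurd h (Set.notMem_empty _)

theorem isTerminal_deleted {u : W} (hu : G.Adj u x) :
    IsTerminal G {x} {s(v, s), s(w, z)} (u, x) :=
  ⟨hu, hu.ne, Or.inl rfl⟩

theorem isTerminal (T : IsTriangleConfiguration G f v s w z x y) (k : Fin 8) :
    IsTerminal G {x} {s(v, s), s(w, z)} (triangleTerminals v s w z x y k) := by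
  fin_cases k
  exacts [⟨T.adj_vs.symm, T.x_ne_s.symm, by simp [triangleTerminals]⟩,
    ⟨T.adj_vs, T.adj_vx.ne, by simp [triangleTerminals]⟩,
    ⟨T.adj_wz, T.adj_wx.ne, by simp [triangleTerminals]⟩,
    ⟨T.adj_wz.symm, T.adj_zx.ne, by simp [triangleTerminals]⟩,
    isTerminal_deleted T.adj_vx, isTerminal_deleted T.adj_wx, isTerminal_deleted T.adj_zx,
    isTerminal_deleted T.adj_xy.symm]

theorem mem_range_or_of_isTerminal {l : W × W}
    (hl : IsTerminal G {x} {s(v, s), s(w, z)} l) :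
    l ∈ Set.range (triangleTerminals v s w z x y) ∨ l.2 = x := by
  obtain ⟨a, b⟩ := l
  obtain ⟨-, -, hb | hab | hab⟩ := hl
  · exact Or.inr hb
  · rcases Sym2.eq_iff.1 hab with ⟨rfl, rfl⟩ | ⟨rfl, rfl⟩
    exacts [Or.inl ⟨1, rfl⟩, Or.inl ⟨0, rfl⟩]
  · rcases Sym2.eq_iff.1 hab with ⟨rfl, rfl⟩ | ⟨rfl, rfl⟩
    exacts [Or.inl ⟨2, rfl⟩, Or.inl ⟨3, rfl⟩]

theorem adj_triangleCorners (T : IsTriangleConfiguration G f v s w z x y) (j : Fin 4) :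
    G.Adj x (triangleCorners v w z y j) := by
  fin_cases j
  exacts [T.adj_zx.symm, T.adj_vx.symm, T.adj_wx.symm, T.adj_xy]

theorem triangleCorners_injective (T : IsTriangleConfiguration G f v s w z x y) (hyv : y ≠ v) :
    Injective (triangleCorners v w z y) := by
  have hyw : y ≠ w := by
    rintro rfl
    exact T.adj_zx.ne' (T.isPoleColoring.eq_of_eq T.adj_wx T.adj_wz
      ((T.isPoleColoring.comm T.adj_wx).trans T.color_xy))
  have hyz : y ≠ z := by
    rintro rfl
    exact T.adj_wx.ne' (T.isPoleColoring.eq_of_eq T.adj_zx T.adj_wz.symm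
      ((T.isPoleColoring.comm T.adj_zx).trans
        (T.color_xy.trans (T.isPoleColoring.comm T.adj_wz))))
  have := T.adj_wz.ne
  have := T.w_ne_v
  have := T.z_ne_v
  intro i j hij
  fin_cases i <;> fin_cases j <;> simp_all [triangleCorners, eq_comm]

theorem triangleTerminals_injective (T : IsTriangleConfiguration G f v s w z x y)
    (hyv : y ≠ v) : Injective (triangleTerminals v s w z x y) := by
  have hc := T.triangleCorners_injective hyv
  have hzy : z ≠ y := hc.ne (a₁ := 0) (a₂ := 3) (by decide)
  have hwy : w ≠ y := hc.ne (a₁ := 2) (a₂ := 3) (by decide)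
  have := T.adj_vs.ne
  have := T.adj_vx.ne
  have := T.adj_wz.ne
  have := T.adj_wx.ne
  have := T.adj_zx.ne
  have := T.w_ne_v
  have := T.z_ne_v
  have := T.x_ne_s
  intro i j hij
  fin_cases i <;> fin_cases j <;> simp_all [triangleTerminals, triangleCorners, eq_comm]

theorem isBoundaryChart (T : IsTriangleConfiguration G f v s w z x y) (hyv : y ≠ v) :
    IsBoundaryChart G {x} {s(v, s), s(w, z)} f (triangleTerminals v s w z x y)
      (f x ∘ triangleCorners v w z y) where
  terminal_injective := T.triangleTerminals_injective hyv
  color_injective := fun i j hij => T.triangleCorners_injective hyv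
    (T.isPoleColoring.eq_of_eq (T.adj_triangleCorners i) (T.adj_triangleCorners j) hij)
  isTerminal := T.isTerminal
  color_notMem := by
    rintro ⟨a, b⟩ hl hlt ⟨j, hj⟩
    obtain rfl : b = x := (mem_range_or_of_isTerminal hl).resolve_left hlt
    obtain rfl := T.isPoleColoring.eq_of_eq (T.adj_triangleCorners j) hl.1.symm
      (hj.trans (T.isPoleColoring.comm hl.1))
    refine hlt ⟨![6, 4, 5, 7] j, ?_⟩
    fin_cases j <;> rfl

theorem realizes (T : IsTriangleConfiguration G f v s w z x y) :
    Realizes G {x} {s(v, s), s(w, z)} f (triangleTerminals v s w z x y)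
      (f x ∘ triangleCorners v w z y) f ![0, 0, 3, 3, 1, 2, 0, 3] where
  isPoleColoring := T.isPoleColoring_cut
  named k := by
    have hcomm {a b : W} (h : G.Adj a b) := T.isPoleColoring.comm h
    fin_cases k
    exacts [(hcomm T.adj_vs.symm).trans T.color_vs, T.color_vs, T.color_xy.symm,
      (hcomm T.adj_wz.symm).trans T.color_xy.symm, hcomm T.adj_vx, hcomm T.adj_wx, hcomm T.adj_zx,
      hcomm T.adj_xy.symm]
  unnamed _ _ _ := rfl

theorem exists_realizes_isGoodBoundary [Finite W] (T : IsTriangleConfiguration G f v s w z x y)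
    (hyv : y ≠ v) : ∃ μ g, Realizes G {x} {s(v, s), s(w, z)} f (triangleTerminals v s w z x y)
      (f x ∘ triangleCorners v w z y) g μ ∧ IsGoodBoundary μ := by
  have hc := T.isBoundaryChart hyv
  obtain ⟨μ, ⟨g, hg⟩, hμ⟩ := exists_isGoodBoundary hc.kempeClosed
    (fun _ ⟨_, hg⟩ => hg.comp_swap hc rfl) (fun _ ⟨_, hg⟩ => hg.comp_swap hc rfl)
    (fun _ ⟨_, hg⟩ => hg.comp_swap hc rfl) ⟨f, T.realizes⟩
  exact ⟨μ, g, hg, hμ⟩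

theorem hasSplitColoring_of_ne [Finite W] [Finite C]
    (T : IsTriangleConfiguration G f v s w z x y) (P : IsNeighborPartition G v N₁ {s})
    (hx : x ∈ N₁) (hyv : y ≠ v) : HasSplitColoring C G v N₁ {s} w z := by
  obtain ⟨μ, g, hg, hμ₀₁, hμ⟩ := T.exists_realizes_isGoodBoundary hyv
  have hc := T.isBoundaryChart hyv
  refine .of_cut P T.w_ne_v T.z_ne_v hx hg.isPoleColoring
    (bijOn_univ_of_injOn (T.isPoleColoring.bijOn x (Set.notMem_empty x)) ?_) ?_
  · have hinj := hg.injOn hc (A := {l | l.2 = x ∧ G.Adj l.1 x}) ?_ ?_ ?_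
    · exact fun u hu u' hu' h =>
        congrArg Prod.fst (@hinj (u, x) ⟨rfl, hu.symm⟩ (u', x) ⟨rfl, hu'.symm⟩ h)
    · rintro ⟨u, _⟩ ⟨rfl, hu⟩
      exact isTerminal_deleted hu
    · rintro ⟨u, _⟩ ⟨rfl, hu⟩ ⟨u', _⟩ ⟨rfl, hu'⟩ h
      exact Prod.ext (T.isPoleColoring.eq_of_eq hu.symm hu'.symm
        ((T.isPoleColoring.comm hu.symm).trans (h.trans (T.isPoleColoring.comm hu')))) rfl
    · have hle (k : Fin 8) (hk : (triangleTerminals v s w z x y k).2 = x) : 4 ≤ k := by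
        have := T.adj_vx.ne
        have := T.adj_wx.ne
        have := T.adj_zx.ne
        have := T.x_ne_s.symm
        fin_cases k <;> simp_all [triangleTerminals]
      exact fun i hi j hj => hμ i j (hle i hi.1) (hle j hj.1)
  · have h₀ : g s v = _ := hg.named 0
    have h₁ : g v s = _ := hg.named 1
    rw [h₀, h₁]
    exact hc.color_injective.ne hμ₀₁

theorem hasSplitColoring_of_eq (T : IsTriangleConfiguration G f v s w z x v)
    (P : IsNeighborPartition G v N₁ {s}) (hx : x ∈ N₁) : HasSplitColoring C G v N₁ {s} w z := by
  classical
  have hvs : IsTerminal G {x} {s(v, s), s(w, z)} (v, s) := T.isTerminal 1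
  have hzw : IsTerminal G {x} {s(v, s), s(w, z)} (z, w) := T.isTerminal 3
  have hcut := (T.isPoleColoring_cut.exchange hvs (isTerminal_deleted T.adj_vx)).exchange hzw
    (isTerminal_deleted T.adj_zx)
  refine .of_cut P T.w_ne_v T.z_ne_v hx hcut ?_ ?_
  · have hrow := bijOn_comp_swap (T.isPoleColoring.bijOn x (Set.notMem_empty x)) T.adj_vx.symm
      T.adj_zx.symm
    refine hrow.congr fun u hu => ?_
    have hxu := T.isPoleColoring.comm hu
    obtain rfl | huz := eq_or_ne u z
    · simp [T.z_ne_v, T.color_xy, T.isPoleColoring.comm T.adj_wz]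
    · obtain rfl | huv := eq_or_ne u v
      · simp [huz, T.color_vs]
      · simp [huz, huv, Equiv.swap_apply_of_ne_of_ne huv huz, hxu]
  · have hne : f v s ≠ f v x := mt (T.isPoleColoring.eq_of_eq T.adj_vs T.adj_vx) T.x_ne_s.symm
    obtain rfl | hsz := eq_or_ne s z
    · simp [T.z_ne_v.symm, T.adj_vs.ne', Equiv.swap_apply_of_ne_of_ne T.w_ne_v.symm T.adj_vx.ne,
        T.isPoleColoring.comm T.adj_vs.symm, hne]
    · simp [hsz, T.z_ne_v.symm, T.adj_vs.ne', T.isPoleColoring.comm T.adj_vs.symm, hne]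

end IsTriangleConfiguration

theorem hasSplitColoring_of_triangle [Finite W] [Finite C] (P : IsNeighborPartition G v N₁ {s})
    (hwz : G.Adj w z) (hwv : w ≠ v) (hzv : z ≠ v) (hf : IsPoleColoring G ∅ ∅ f) (hx : x ∈ N₁)
    (hwx : G.Adj w x) (hzx : G.Adj z x) : HasSplitColoring C G v N₁ {s} w z := by
  by_contra hbad
  obtain ⟨f', hf', _, rfl, hvs⟩ := exists_color_mem_right P (Set.singleton_nonempty s) hwz.symm hzv
    hwv (fun h => hbad h.swap_ends) hf hzx hwx.ne'
  obtain ⟨y, hxy, hy⟩ := (hf'.bijOn x (Set.notMem_empty x)).surjOn (Set.mem_univ (f' w z))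
  have T : IsTriangleConfiguration G f' v _ w z x y := ⟨hf', P.adj_right rfl, P.adj_left hx, hwz,
    hwx, hzx, hxy, hwv, hzv, P.ne hx rfl, hvs.trans (hf'.comm hzx), hy⟩
  obtain rfl | hyv := eq_or_ne y v
  · exact hbad (T.hasSplitColoring_of_eq P hx)
  · exact hbad (T.hasSplitColoring_of_ne P hx hyv)

end Triangle

section Counting

variable {W C : Type*} [Fintype W] {G : SimpleGraph W} [DecidableRel G.Adj] {v w z : W}
  {N₁ N₂ : Set W} {f : W → W → C}

-- Apart from `v`, `w`, `z`, `s`, a vertex that is not adjacent to all of `v`, `w`, `z` is one of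
-- the remaining non-neighbors of `v`, `w` or `z`, of which there are at most `|W| - δ - 3` for `v`
-- and `|W| - δ - 2` for each of `w` and `z`.
theorem exists_common_neighbor (hδ : 2 * Fintype.card W ≤ 3 * G.minDegree + 2) (hvw : v ≠ w)
    (hvz : v ≠ z) (hwz : w ≠ z) (hnvw : ¬ G.Adj v w) (hnvz : ¬ G.Adj v z) (s : W) :
    ∃ x ≠ s, G.Adj v x ∧ G.Adj w x ∧ G.Adj z x := by
  classical
  by_contra! h
  have hcard (u : W) (A : Finset W) (hA : ∀ a ∈ A, ¬ G.Adj u a) :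
      ((G.neighborFinset u)ᶜ \ A).card + A.card + G.minDegree ≤ Fintype.card W := by
    rw [Finset.card_sdiff_add_card_eq_card fun a ha => by simpa using hA a ha,
      ← Finset.card_compl_add_card (G.neighborFinset u), G.card_neighborFinset_eq_degree]
    exact Nat.add_le_add_left (G.minDegree_le_degree u) _
  have hv := hcard v {v, w, z} (by simp [hnvw, hnvz])
  have hw := hcard w {v, w} (by simp [G.adj_comm w, hnvw])
  have hz := hcard z {v, z} (by simp [G.adj_comm z, hnvz])
  rw [Finset.card_eq_three.2 ⟨v, w, z, hvw, hvz, hwz, rfl⟩] at hv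
  rw [Finset.card_pair hvw] at hw
  rw [Finset.card_pair hvz] at hz
  have hcover : Finset.univ ⊆ {v, w, z, s} ∪ ((G.neighborFinset v)ᶜ \ {v, w, z} ∪
      ((G.neighborFinset w)ᶜ \ {v, w} ∪ (G.neighborFinset z)ᶜ \ {v, z})) := fun x _ => by
    have := h x
    simp only [Finset.mem_union, Finset.mem_insert, Finset.mem_singleton, Finset.mem_sdiff,
      Finset.mem_compl, mem_neighborFinset]
    tauto
  have := (Finset.card_le_card hcover).trans (Finset.card_union_le _ _)
  have := Finset.card_union_le ((G.neighborFinset v)ᶜ \ {v, w, z})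
    ((G.neighborFinset w)ᶜ \ {v, w} ∪ (G.neighborFinset z)ᶜ \ {v, z})
  have := Finset.card_union_le ((G.neighborFinset w)ᶜ \ {v, w}) ((G.neighborFinset z)ᶜ \ {v, z})
  have := Finset.card_le_four (a := v) (b := w) (c := z) (d := s)
  rw [Finset.card_univ] at *
  omega

theorem hasSplitColoring_of_not_adj [Finite C] (hδ : 2 * Fintype.card W ≤ 3 * G.minDegree + 2)
    (P : IsNeighborPartition G v N₁ N₂) (hN₁ : N₁.Nonempty) (hN₂ : N₂.Nonempty)
    (hf : IsPoleColoring G ∅ ∅ f) (hwz : G.Adj w z) (hwv : w ≠ v) (hzv : z ≠ v)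
    (hvw : ¬ G.Adj v w) (hvz : ¬ G.Adj v z) : HasSplitColoring C G v N₁ N₂ w z := by
  have hcommon := exists_common_neighbor hδ hwv.symm hzv.symm hwz.ne hvw hvz
  have hsub {M : Set W} {s : W} (Q : IsNeighborPartition G v M {s}) :
      HasSplitColoring C G v M {s} w z := by
    obtain ⟨x, hxs, hvx, hwx, hzx⟩ := hcommon s
    exact hasSplitColoring_of_triangle Q hwz hwv hzv hf ((Q.mem_or_mem hvx).resolve_right hxs)
      hwx hzx
  rcases hN₂.exists_eq_singleton_or_nontrivial with ⟨s, rfl⟩ | hN₂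
  · exact hsub P
  rcases hN₁.exists_eq_singleton_or_nontrivial with ⟨s, rfl⟩ | hN₁
  · exact (hsub P.symm).swap_sides
  obtain ⟨x, -, hvx, hwx, hzx⟩ := hcommon v
  rcases P.mem_or_mem hvx with hx | hx
  · exact hasSplitColoring_of_nontrivial P hN₂ hwz hwv hzv hf hx hwx hzx.ne'
  · exact (hasSplitColoring_of_nontrivial P.symm hN₁ hwz hwv hzv hf hx hwx hzx.ne').swap_sides

theorem hasSplitColoring_of_minDegree [Finite C] (hδ : 2 * Fintype.card W ≤ 3 * G.minDegree + 2)
    (P : IsNeighborPartition G v N₁ N₂) (hN₁ : N₁.Nonempty) (hN₂ : N₂.Nonempty)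
    (hf : IsPoleColoring G ∅ ∅ f) (hwz : G.Adj w z) (hwv : w ≠ v) (hzv : z ≠ v) :
    HasSplitColoring C G v N₁ N₂ w z := by
  have hnear {a b : W} (hab : G.Adj a b) (hbv : b ≠ v) (hva : G.Adj v a) :
      HasSplitColoring C G v N₁ N₂ a b := by
    rcases P.mem_or_mem hva with ha | ha
    · exact hasSplitColoring_of_mem_left P hN₂ hf ha hab hbv
    · exact (hasSplitColoring_of_mem_left P.symm hN₁ hf ha hab hbv).swap_sides
  by_cases hvw : G.Adj v w
  · exact hnear hwz hzv hvw
  by_cases hvz : G.Adj v z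
  · exact (hnear hwz.symm hwv hvz).swap_ends
  exact hasSplitColoring_of_not_adj hδ P hN₁ hN₂ hf hwz hwv hzv hvw hvz

end Counting

section LineGraph

variable {V C : Type*} {G : SimpleGraph V}

theorem chromaticIndex_le_iff {k : ℕ} : chromaticIndex G ≤ k ↔ G.lineGraph.Colorable k :=
  chromaticNumber_le_iff_colorable

/-- A proper edge coloring, given as a function of the endpoints of an edge. -/
structure IsEdgeColoring (G : SimpleGraph V) (g : V → V → C) : Prop where
  symm (u y : V) : G.Adj u y → g u y = g y u
  injOn (u : V) : Set.InjOn (g u) (G.neighborSet u)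

theorem IsEdgeColoring.nonempty_coloring {g : V → V → C} (hg : IsEdgeColoring G g) :
    Nonempty (G.lineGraph.Coloring C) := by
  have hval (e : G.edgeSet) : ∃ c, ∀ u y, s(u, y) = e.1 → g u y = c := by
    obtain ⟨⟨a, b⟩, hab⟩ := e
    refine ⟨g a b, fun u y h => ?_⟩
    rcases Sym2.eq_iff.1 h with ⟨rfl, rfl⟩ | ⟨rfl, rfl⟩
    exacts [rfl, (hg.symm _ _ hab).symm]
  choose c hc using hval
  refine ⟨Coloring.mk c ?_⟩
  rintro ⟨e, he⟩ ⟨e', he'⟩ ⟨hne, u, hu, hu'⟩ heq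
  obtain ⟨y, rfl⟩ := Sym2.mem_iff_exists.1 hu
  obtain ⟨y', rfl⟩ := Sym2.mem_iff_exists.1 hu'
  rw [← hc _ u y rfl, ← hc _ u y' rfl] at heq
  obtain rfl := hg.injOn u he he' heq
  exact hne rfl

theorem exists_isEdgeColoring [Nonempty C] (c : G.lineGraph.Coloring C) :
    ∃ g : V → V → C, IsEdgeColoring G g := by
  classical
  refine ⟨fun u y => if h : G.Adj u y then c ⟨s(u, y), h⟩ else Classical.arbitrary C,
    fun u y h => ?_, fun u y h y' h' heq => ?_⟩
  · simp only [dif_pos h, dif_pos h.symm, Sym2.eq_swap]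
  · rw [dif_pos ((G.mem_neighborSet u y).1 h), dif_pos ((G.mem_neighborSet u y').1 h')] at heq
    by_contra hne
    exact c.valid ⟨fun he => hne (Sym2.congr_right.1 (congrArg Subtype.val he)), u,
      Sym2.mem_mk_left u y, Sym2.mem_mk_left u y'⟩ heq

theorem colorable_lineGraph_of_deleteEdges_singleton {e : Sym2 V} {k : ℕ}
    (h : (G.deleteEdges {e}).lineGraph.Colorable k) : G.lineGraph.Colorable (k + 1) := by
  classical
  obtain ⟨c⟩ := h
  have hmem (e' : G.edgeSet) (he' : e'.1 ≠ e) : e'.1 ∈ (G.deleteEdges {e}).edgeSet := by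
    rw [edgeSet_deleteEdges]
    exact ⟨e'.2, he'⟩
  refine ⟨Coloring.mk
    (fun e' => if he' : e'.1 = e then Fin.last k else (c ⟨e'.1, hmem e' he'⟩).castSucc) ?_⟩
  rintro e₁ e₂ ⟨hne, hadj⟩
  by_cases he₁ : e₁.1 = e <;> by_cases he₂ : e₂.1 = e
  · exact absurd (Subtype.ext (he₁.trans he₂.symm)) hne
  · simpa only [dif_pos he₁, dif_neg he₂] using (Fin.castSucc_lt_last _).ne'
  · simpa only [dif_neg he₁, dif_pos he₂] using (Fin.castSucc_lt_last _).ne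
  · simp only [dif_neg he₁, dif_neg he₂]
    exact (Fin.castSucc_injective k).ne
      (c.valid ⟨fun h => hne (Subtype.ext (Subtype.mk.inj h)), hadj⟩)

theorem two_mul_card_colorClass_le [Fintype V] [Fintype G.edgeSet] [DecidableEq C]
    (c : G.lineGraph.Coloring C) (i : C) :
    (Finset.univ.filter fun e => c e = i).card * 2 ≤ Fintype.card V := by
  classical
  rw [← Finset.sum_const_nat (m := 2) (f := fun e : G.edgeSet => e.1.toFinset.card)
    fun e _ => Sym2.card_toFinset_of_not_isDiag _ (G.not_isDiag_of_mem_edgeSet e.2),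
    ← Finset.card_biUnion]
  · exact Finset.card_le_univ _
  · intro e he e' he' hne
    rw [onFun, Finset.disjoint_left]
    intro u hu hu'
    exact c.valid ⟨hne, u, Sym2.mem_toFinset.1 hu, Sym2.mem_toFinset.1 hu'⟩
      ((Finset.mem_filter.1 he).2.trans (Finset.mem_filter.1 he').2.symm)

theorem card_edgeFinset_le_mul [Fintype V] [Fintype G.edgeSet] {k : ℕ}
    (h : G.lineGraph.Colorable k) : G.edgeFinset.card ≤ k * (Fintype.card V / 2) := by
  obtain ⟨c⟩ := h
  rw [edgeFinset_card, ← Finset.card_univ,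
    Finset.card_eq_sum_card_fiberwise (t := Finset.univ) (f := c) (by simp)]
  calc _ ≤ ∑ _i : Fin k, Fintype.card V / 2 := Finset.sum_le_sum fun i _ =>
        (Nat.le_div_iff_mul_le two_pos).2 (two_mul_card_colorClass_le c i)
    _ = _ := by simp

theorem IsOverfull.not_colorable [Fintype V] [DecidableRel G.Adj] (h : IsOverfull G) :
    ¬ G.lineGraph.Colorable G.maxDegree :=
  fun hc => h.not_ge (card_edgeFinset_le_mul hc)

theorem exists_isPoleColoring_of_isRegularOfDegree [G.LocallyFinite] {k : ℕ}
    (hreg : G.IsRegularOfDegree k) (hk : 0 < k) (h : G.lineGraph.Colorable k) :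
    ∃ f : V → V → Fin k, IsPoleColoring G ∅ ∅ f := by
  obtain ⟨c⟩ := h
  have : Nonempty (Fin k) := ⟨⟨0, hk⟩⟩
  obtain ⟨g, hg⟩ := exists_isEdgeColoring c
  refine ⟨g, fun u _ => ⟨Set.mapsTo_univ _ _, hg.injOn u, ?_⟩, fun u y huy _ _ _ =>
    hg.symm u y huy⟩
  have hinj : Set.InjOn (g u) (G.neighborFinset u) := by
    rw [coe_neighborFinset]
    exact hg.injOn u
  have hsurj := Finset.surjOn_of_injOn_of_card_le (t := Finset.univ) (g u)
    (fun _ _ => Finset.mem_coe.2 (Finset.mem_univ _)) hinj (by simp [hreg.degree_eq u])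
  rwa [coe_neighborFinset, Finset.coe_univ] at hsurj

theorem IsPoleColoring.even_card [Fintype V] [Nonempty C] {f : V → V → C}
    (hf : IsPoleColoring G ∅ ∅ f) : Even (Fintype.card V) := by
  obtain ⟨c⟩ := ‹Nonempty C›
  choose m hm hmc using fun u => (hf.bijOn u (Set.notMem_empty u)).surjOn (Set.mem_univ c)
  have hmm (u : V) : m (m u) = u := hf.eq_of_eq (hm (m u)) (Adj.symm (hm u)) <| by
    rw [hmc, ← hf.comm (hm u), hmc]
  have h : ∑ _u : V, (1 : ZMod 2) = 0 := Finset.sum_involution (fun u _ => m u)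
    (fun _ _ => by decide) (fun u _ _ => Adj.ne' (hm u))
    (fun _ _ => Finset.mem_univ _) fun u _ => hmm u
  rw [Finset.sum_const, Finset.card_univ, nsmul_eq_mul, mul_one] at h
  exact ZMod.natCast_eq_zero_iff_even.1 h

end LineGraph

section Critical

theorem chromaticIndex_le_of_copy {V V' : Type*} {G : SimpleGraph V} {G' : SimpleGraph V'}
    (φ : Copy G G') : chromaticIndex G ≤ chromaticIndex G' :=
  chromaticNumber_mono_of_hom φ.toLineGraphEmbedding.toHom

theorem isEdgeChromaticCritical_of_isCriticalEdge {V : Type*} {G : SimpleGraph V}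
    (hG : ∀ u, ∃ y, G.Adj u y) (h : ∀ e ∈ G.edgeSet, IsCriticalEdge G e) :
    IsEdgeChromaticCritical G := by
  intro H hH
  obtain ⟨a, b, hab, hnab⟩ : ∃ a b, G.Adj a b ∧ ¬ H.Adj a b := by
    by_contra! hall
    refine hH (Subgraph.ext (Set.eq_univ_of_forall fun u => ?_) ?_)
    · obtain ⟨y, hy⟩ := hG u
      exact H.edge_vert (hall u y hy)
    · ext u y
      exact ⟨fun huy => H.adj_sub huy, hall u y⟩
  refine (chromaticIndex_le_of_copy ⟨⟨Subtype.val, fun {p q} hpq => ?_⟩,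
    Subtype.val_injective⟩).trans_lt (h s(a, b) hab).2
  refine deleteEdges_adj.2 ⟨H.adj_sub hpq, fun heq => hnab ?_⟩
  rw [← Subgraph.mem_edgeSet, ← Set.mem_singleton_iff.1 heq]
  exact hpq

variable {V : Type*} [Fintype V] {G : SimpleGraph V} [DecidableRel G.Adj]

theorem IsOverfull.maxDegree_lt_chromaticIndex (h : IsOverfull G) :
    (G.maxDegree : ℕ∞) < chromaticIndex G :=
  not_le.1 (chromaticIndex_le_iff.not.2 h.not_colorable)

theorem IsOverfull.isClassTwo (h : IsOverfull G) : IsClassTwo G :=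
  h.maxDegree_lt_chromaticIndex.ne'

theorem IsOverfull.isCriticalEdge (h : IsOverfull G) {e : Sym2 V} (he : e ∈ G.edgeSet)
    (hdel : (G.deleteEdges {e}).lineGraph.Colorable G.maxDegree) : IsCriticalEdge G e :=
  ⟨he, (chromaticIndex_le_iff.2 hdel).trans_lt h.maxDegree_lt_chromaticIndex⟩

theorem IsOverfull.isDeltaCritical (h : IsOverfull G) (hG : ∀ u, ∃ y, G.Adj u y)
    (hdel : ∀ e ∈ G.edgeSet, (G.deleteEdges {e}).lineGraph.Colorable G.maxDegree) :
    IsDeltaCritical G G.maxDegree := by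
  obtain ⟨e, he⟩ := Finset.card_pos.1 (Nat.zero_lt_of_lt h)
  have hle := chromaticIndex_le_iff.2
    (colorable_lineGraph_of_deleteEdges_singleton (hdel e (mem_edgeFinset.1 he)))
  refine ⟨rfl, isEdgeChromaticCritical_of_isCriticalEdge hG fun e he =>
    h.isCriticalEdge he (hdel e he), le_antisymm (by exact_mod_cast hle) ?_⟩
  exact Order.add_one_le_of_lt h.maxDegree_lt_chromaticIndex

end Critical

section SplitGraph

variable {W C : Type*} {G : SimpleGraph W} {v : W} {N₁ N₂ : Set W} {f : W → W → C}
  {a b : {w : W // w ≠ v}} {i j : Bool}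

/-- The old neighbors `N₁` or `N₂` of the half `Sum.inr i` of the split vertex. -/
def side (N₁ N₂ : Set W) (i : Bool) : Set W := cond i N₂ N₁

theorem splitGraph_adj_inl_inr :
    (splitGraph G v N₁ N₂).Adj (Sum.inl a) (Sum.inr i) ↔ (a : W) ∈ side N₁ N₂ i := by
  cases i <;> rfl

theorem splitGraph_adj_inr_inl :
    (splitGraph G v N₁ N₂).Adj (Sum.inr i) (Sum.inl a) ↔ (a : W) ∈ side N₁ N₂ i := by
  cases i <;> rfl

theorem splitGraph_adj_inr_inr : (splitGraph G v N₁ N₂).Adj (Sum.inr i) (Sum.inr j) ↔ i ≠ j := by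
  cases i <;> cases j <;> rfl

theorem IsNeighborPartition.adj_of_mem_side (P : IsNeighborPartition G v N₁ N₂) {y : W}
    (hy : y ∈ side N₁ N₂ i) : G.Adj v y := by
  cases i
  exacts [P.adj_left hy, P.adj_right hy]

theorem IsNeighborPartition.exists_mem_side (P : IsNeighborPartition G v N₁ N₂) {y : W}
    (hy : G.Adj v y) : ∃ i, y ∈ side N₁ N₂ i :=
  (P.mem_or_mem hy).elim (fun h => ⟨false, h⟩) fun h => ⟨true, h⟩

theorem IsNeighborPartition.side_eq (P : IsNeighborPartition G v N₁ N₂) {y : W}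
    (hi : y ∈ side N₁ N₂ i) (hj : y ∈ side N₁ N₂ j) : i = j := by
  cases i <;> cases j
  exacts [rfl, absurd rfl (P.ne hi hj), absurd rfl (P.ne hj hi), rfl]

/-- The map from the vertices of the split graph to those of `G` that merges the two halves
of `v`. -/
def collapse (v : W) : {w : W // w ≠ v} ⊕ Bool → W := Sum.elim Subtype.val fun _ => v

theorem IsNeighborPartition.bijOn_collapse (P : IsNeighborPartition G v N₁ N₂)
    (a : {w : W // w ≠ v}) :
    Set.BijOn (collapse v) ((splitGraph G v N₁ N₂).neighborSet (Sum.inl a)) (G.neighborSet a) := by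
  refine ⟨?_, ?_, fun y hy => ?_⟩
  · rintro (b | i) h
    exacts [h, (P.adj_of_mem_side (splitGraph_adj_inl_inr.1 h)).symm]
  · rintro (b | i) h (b' | i') h' heq
    · exact congrArg Sum.inl (Subtype.ext heq)
    · exact absurd heq b.2
    · exact absurd heq.symm b'.2
    · exact congrArg Sum.inr
        (P.side_eq (splitGraph_adj_inl_inr.1 h) (splitGraph_adj_inl_inr.1 h'))
  · by_cases hyv : y = v
    · subst hyv
      obtain ⟨i, hi⟩ := P.exists_mem_side (Adj.symm hy)
      exact ⟨Sum.inr i, splitGraph_adj_inl_inr.2 hi, rfl⟩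
    · exact ⟨Sum.inl ⟨y, hyv⟩, hy, rfl⟩

/-- The coloring of the split graph induced by a coloring of the half-edges of `G` and a color `γ`
for the new edge; at `v` it uses the color of the half-edge pointing to `v`. -/
def splitColoring (v : W) (f : W → W → C) (γ : C) (p q : {w : W // w ≠ v} ⊕ Bool) : C :=
  match p, q with
  | Sum.inl a, q => f a (collapse v q)
  | Sum.inr _, Sum.inl b => f b v
  | Sum.inr _, Sum.inr _ => γ

theorem IsNeighborPartition.isEdgeColoring_splitColoring (P : IsNeighborPartition G v N₁ N₂)
    {H : SimpleGraph ({w : W // w ≠ v} ⊕ Bool)} (hH : H ≤ splitGraph G v N₁ N₂) {γ : C}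
    (hrow : ∀ u ≠ v, Set.InjOn (f u) (G.neighborSet u))
    (hsymm : ∀ a b : {w : W // w ≠ v}, H.Adj (Sum.inl a) (Sum.inl b) → f a b = f b a)
    (hside : ∀ i, Set.InjOn (fun y => f y v) (side N₁ N₂ i))
    (hγ : ∀ i j (a : {w : W // w ≠ v}), H.Adj (Sum.inr i) (Sum.inr j) →
      H.Adj (Sum.inr i) (Sum.inl a) → f a v ≠ γ) :
    IsEdgeColoring H (splitColoring v f γ) where
  symm := by
    rintro (a | i) (b | j) h
    exacts [hsymm a b h, rfl, rfl, rfl]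
  injOn := by
    rintro (a | i)
    · have hcol := P.bijOn_collapse a
      exact ((hrow a a.2).comp hcol.injOn hcol.mapsTo).mono fun q h => hH h
    · rintro (b | j) h (b' | j') h' heq
      · exact congrArg Sum.inl (Subtype.ext (hside i (splitGraph_adj_inr_inl.1 (hH h))
          (splitGraph_adj_inr_inl.1 (hH h')) heq))
      · exact absurd heq (hγ i j' b h' h)
      · exact absurd heq.symm (hγ i j b' h h')
      · exact congrArg Sum.inr ((Bool.eq_not.2 (splitGraph_adj_inr_inr.1 (hH h)).symm).trans
          (Bool.eq_not.2 (splitGraph_adj_inr_inr.1 (hH h')).symm).symm)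

theorem HasSplitColoring.nonempty_coloring (P : IsNeighborPartition G v N₁ N₂)
    (h : HasSplitColoring C G v N₁ N₂ a b) :
    Nonempty
      (((splitGraph G v N₁ N₂).deleteEdges {s(Sum.inl a, Sum.inl b)}).lineGraph.Coloring C) := by
  obtain ⟨f, γ, hf, hN₁, hN₂, hγ⟩ := h
  refine (P.isEdgeColoring_splitColoring (f := f) (γ := γ) (deleteEdges_le _)
    (fun u hu => (hf.bijOn u hu).injOn) (fun c d h => ?_) ?_
    fun i j c _ h => hγ c (P.adj_of_mem_side (splitGraph_adj_inr_inl.1 h.1))).nonempty_coloring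
  · rw [deleteEdges_adj] at h
    refine hf.symm c d h.1 c.2 d.2 fun hcd => h.2 ?_
    rcases Sym2.eq_iff.1 hcd with ⟨hc, hd⟩ | ⟨hc, hd⟩
    · rw [Subtype.ext hc, Subtype.ext hd, Set.mem_singleton_iff]
    · rw [Subtype.ext hc, Subtype.ext hd, Sym2.eq_swap, Set.mem_singleton_iff]
  · rintro (_ | _)
    exacts [hN₁, hN₂]

theorem IsPoleColoring.nonempty_coloring_of_le_splitGraph (hf : IsPoleColoring G ∅ ∅ f)
    (P : IsNeighborPartition G v N₁ N₂) {H : SimpleGraph ({w : W // w ≠ v} ⊕ Bool)}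
    (hH : H ≤ splitGraph G v N₁ N₂) {γ : C}
    (hγ : ∀ i j (a : {w : W // w ≠ v}), H.Adj (Sum.inr i) (Sum.inr j) →
      H.Adj (Sum.inr i) (Sum.inl a) → f v a ≠ γ) :
    Nonempty (H.lineGraph.Coloring C) := by
  have hcomm {i : Bool} {y : W} (hy : y ∈ side N₁ N₂ i) : f v y = f y v :=
    hf.comm (P.adj_of_mem_side hy)
  refine (P.isEdgeColoring_splitColoring (f := f) (γ := γ) hH
    (fun u _ => (hf.bijOn u (Set.notMem_empty u)).injOn) (fun a b h => hf.comm (hH h))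
    (fun i y hy y' hy' heq => hf.eq_of_eq (P.adj_of_mem_side hy) (P.adj_of_mem_side hy') ?_)
    fun i j a h h' => ?_).nonempty_coloring
  · rw [hcomm hy, hcomm hy']
    exact heq
  · rw [← hcomm (splitGraph_adj_inr_inl.1 (hH h'))]
    exact hγ i j a h h'

theorem IsPoleColoring.nonempty_coloring_delete_new (hf : IsPoleColoring G ∅ ∅ f) [Nonempty C]
    (P : IsNeighborPartition G v N₁ N₂) (hij : i ≠ j) :
    Nonempty
      (((splitGraph G v N₁ N₂).deleteEdges {s(Sum.inr i, Sum.inr j)}).lineGraph.Coloring C) := by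
  refine hf.nonempty_coloring_of_le_splitGraph P (deleteEdges_le _)
    (γ := Classical.arbitrary C) fun k l _ h _ => absurd ?_ (deleteEdges_adj.1 h).2
  have hkl := splitGraph_adj_inr_inr.1 h.1
  cases i <;> cases j <;> cases k <;> cases l <;> simp_all

-- The color of the deleted edge becomes free for the new edge.
theorem IsPoleColoring.nonempty_coloring_delete_old (hf : IsPoleColoring G ∅ ∅ f)
    (P : IsNeighborPartition G v N₁ N₂) (ha : (a : W) ∈ side N₁ N₂ i) :
    Nonempty
      (((splitGraph G v N₁ N₂).deleteEdges {s(Sum.inr i, Sum.inl a)}).lineGraph.Coloring C) := by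
  refine hf.nonempty_coloring_of_le_splitGraph P (deleteEdges_le _) (γ := f v a)
    fun j _ b _ hb heq => (deleteEdges_adj.1 hb).2 ?_
  have hbj := splitGraph_adj_inr_inl.1 hb.1
  obtain rfl : b = a :=
    Subtype.ext (hf.eq_of_eq (P.adj_of_mem_side hbj) (P.adj_of_mem_side ha) heq)
  rw [P.side_eq hbj ha]
  exact Set.mem_singleton _

theorem IsNeighborPartition.degree_splitGraph_inl (P : IsNeighborPartition G v N₁ N₂)
    (a : {w : W // w ≠ v}) [Fintype ((splitGraph G v N₁ N₂).neighborSet (Sum.inl a))]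
    [Fintype (G.neighborSet a)] : (splitGraph G v N₁ N₂).degree (Sum.inl a) = G.degree a := by
  rw [← card_neighborSet_eq_degree, ← card_neighborSet_eq_degree]
  exact Fintype.card_congr (P.bijOn_collapse a).equiv

theorem IsNeighborPartition.degree_splitGraph_inr (P : IsNeighborPartition G v N₁ N₂) (i : Bool)
    [Fintype ((splitGraph G v N₁ N₂).neighborSet (Sum.inr i))] :
    (splitGraph G v N₁ N₂).degree (Sum.inr i) = (side N₁ N₂ i).ncard + 1 := by
  have hset : (splitGraph G v N₁ N₂).neighborSet (Sum.inr i) =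
      insert (Sum.inr !i) (Sum.inl '' (Subtype.val ⁻¹' side N₁ N₂ i)) := by
    ext (b | j)
    · simp [splitGraph_adj_inr_inl]
    · cases i <;> cases j <;> simp [splitGraph_adj_inr_inr]
  have hfin : (Sum.inl '' (Subtype.val ⁻¹' side N₁ N₂ i) : Set ({w : W // w ≠ v} ⊕ Bool)).Finite :=
    (Set.toFinite ((splitGraph G v N₁ N₂).neighborSet (Sum.inr i))).subset (by simp [hset])
  have hrange : side N₁ N₂ i ⊆ Set.range (Subtype.val : {w : W // w ≠ v} → W) := fun y hy =>
    ⟨⟨y, (P.adj_of_mem_side hy).ne'⟩, rfl⟩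
  rw [← card_neighborSet_eq_degree, ← Nat.card_eq_fintype_card, Nat.card_coe_set_eq, hset,
    Set.ncard_insert_of_notMem (by simp) hfin, Set.ncard_image_of_injective _ Sum.inl_injective,
    Set.ncard_preimage_of_injective_subset_range Subtype.val_injective hrange]

end SplitGraph

section Splitting

variable {W V : Type*} {G : SimpleGraph W} {v : W} {N₁ N₂ : Set W} {H : SimpleGraph V}

theorem IsNeighborPartition.ncard_side_add (P : IsNeighborPartition G v N₁ N₂)
    [Fintype (G.neighborSet v)] :
    (side N₁ N₂ true).ncard + (side N₁ N₂ false).ncard = G.degree v := by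
  have hfin : (N₁ ∪ N₂).Finite := by
    rw [P.union_eq]
    exact Set.toFinite _
  rw [← card_neighborSet_eq_degree, ← Nat.card_eq_fintype_card, Nat.card_coe_set_eq, ← P.union_eq,
    Set.ncard_union_eq P.disjoint (hfin.subset Set.subset_union_left)
      (hfin.subset Set.subset_union_right), add_comm]
  rfl

theorem IsNeighborPartition.colorable_deleteEdges_splitGraph [Fintype W] [DecidableRel G.Adj]
    (P : IsNeighborPartition G v N₁ N₂) (hN₁ : N₁.Nonempty) (hN₂ : N₂.Nonempty) {k : ℕ}
    (hδ : 2 * Fintype.card W ≤ 3 * G.minDegree + 2) {f : W → W → Fin k}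
    (hf : IsPoleColoring G ∅ ∅ f) {p q : {w : W // w ≠ v} ⊕ Bool}
    (h : (splitGraph G v N₁ N₂).Adj p q) :
    ((splitGraph G v N₁ N₂).deleteEdges {s(p, q)}).lineGraph.Colorable k := by
  obtain ⟨y, hy⟩ := hN₁
  have : Nonempty (Fin k) := ⟨f v y⟩
  rcases p with a | i <;> rcases q with b | j
  · exact (hasSplitColoring_of_minDegree hδ P ⟨y, hy⟩ hN₂ hf h a.2 b.2).nonempty_coloring P
  · rw [Sym2.eq_swap]
    exact hf.nonempty_coloring_delete_old P (splitGraph_adj_inl_inr.1 h)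
  · exact hf.nonempty_coloring_delete_old P (splitGraph_adj_inr_inl.1 h)
  · exact hf.nonempty_coloring_delete_new P (splitGraph_adj_inr_inr.1 h)

theorem colorable_lineGraph_deleteEdges_of_iso {V' : Type*} {H' : SimpleGraph V'} {k : ℕ}
    (φ : H ≃g H') {u y : V} (h : (H'.deleteEdges {s(φ u, φ y)}).lineGraph.Colorable k) :
    (H.deleteEdges {s(u, y)}).lineGraph.Colorable k := by
  let ψ : Copy (H.deleteEdges {s(u, y)}) (H'.deleteEdges {s(φ u, φ y)}) := by
    refine ⟨⟨φ, fun {p q} hpq => ?_⟩, φ.injective⟩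
    rw [deleteEdges_adj] at hpq ⊢
    exact ⟨φ.map_adj_iff.2 hpq.1, fun heq => hpq.2 (Sym2.map.injective φ.injective heq)⟩
  exact h.of_hom ψ.toLineGraphEmbedding

theorem IsNeighborPartition.exists_adj_of_iso (P : IsNeighborPartition G v N₁ N₂)
    (φ : H ≃g splitGraph G v N₁ N₂) (hG : ∀ u, ∃ y, G.Adj u y) (u : V) : ∃ y, H.Adj u y := by
  have h : ∃ q, (splitGraph G v N₁ N₂).Adj (φ u) q := by
    rcases φ u with a | i
    · obtain ⟨y, hy⟩ := hG a
      obtain ⟨q, hq, _⟩ := (P.bijOn_collapse a).surjOn hy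
      exact ⟨q, hq⟩
    · exact ⟨Sum.inr !i, splitGraph_adj_inr_inr.2 (Bool.not_ne_self i).symm⟩
  obtain ⟨q, hq⟩ := h
  exact ⟨φ.symm q, φ.map_adj_iff.1 (by rwa [φ.apply_symm_apply])⟩

variable [Fintype W] [Fintype V]

theorem card_eq_add_one_of_iso (φ : H ≃g splitGraph G v N₁ N₂) :
    Fintype.card V = Fintype.card W + 1 := by
  classical
  have hpos : 0 < Fintype.card W := Fintype.card_pos_iff.2 ⟨v⟩
  rw [Fintype.card_congr φ.toEquiv, Fintype.card_sum, Fintype.card_bool]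
  simp only [ne_eq, Fintype.card_subtype_compl, Fintype.card_unique]
  omega

variable [DecidableRel G.Adj] [DecidableRel H.Adj]

theorem IsNeighborPartition.card_edgeFinset_of_iso (P : IsNeighborPartition G v N₁ N₂)
    (φ : H ≃g splitGraph G v N₁ N₂) : H.edgeFinset.card = G.edgeFinset.card + 1 := by
  classical
  have hS : (splitGraph G v N₁ N₂).edgeFinset.card = G.edgeFinset.card + 1 := by
    have hsum := (splitGraph G v N₁ N₂).sum_degrees_eq_twice_card_edges
    rw [Fintype.sum_sum_type, Fintype.sum_bool, P.degree_splitGraph_inr, P.degree_splitGraph_inr,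
      Fintype.sum_congr _ _ fun a => P.degree_splitGraph_inl a] at hsum
    have hG := G.sum_degrees_eq_twice_card_edges
    rw [Fintype.sum_eq_add_sum_subtype_ne _ v, ← P.ncard_side_add] at hG
    omega
  rw [← hS]
  exact φ.card_edgeFinset_eq

theorem IsNeighborPartition.maxDegree_of_iso (P : IsNeighborPartition G v N₁ N₂)
    (hN₁ : N₁.Nonempty) (hN₂ : N₂.Nonempty) (φ : H ≃g splitGraph G v N₁ N₂) {k : ℕ}
    (hreg : G.IsRegularOfDegree k) : H.maxDegree = k := by
  classical
  have hdeg (a : {w : W // w ≠ v}) : (splitGraph G v N₁ N₂).degree (Sum.inl a) = k :=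
    (P.degree_splitGraph_inl a).trans (hreg a)
  refine le_antisymm (H.maxDegree_le_of_forall_degree_le k fun u => ?_) ?_
  · rw [← φ.degree_eq]
    rcases φ u with a | i
    · exact (hdeg a).le
    · have hadd := P.ncard_side_add.trans (hreg v)
      have h₁ := (Set.ncard_pos (Set.toFinite _)).2 hN₁
      have h₂ := (Set.ncard_pos (Set.toFinite _)).2 hN₂
      rw [P.degree_splitGraph_inr]
      cases i <;> simp only [side, cond_true, cond_false] at hadd ⊢ <;> omega
  · obtain ⟨x, hx⟩ := hN₁
    rw [← hdeg ⟨x, (P.adj_left hx).ne'⟩, ← φ.symm.degree_eq]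
    exact H.degree_le_maxDegree _

theorem IsNeighborPartition.isOverfull_of_iso (P : IsNeighborPartition G v N₁ N₂)
    (hN₁ : N₁.Nonempty) (hN₂ : N₂.Nonempty) (φ : H ≃g splitGraph G v N₁ N₂) {k : ℕ}
    (hreg : G.IsRegularOfDegree k) (heven : Even (Fintype.card W)) : IsOverfull H := by
  obtain ⟨r, hr⟩ := heven
  have hE : 2 * G.edgeFinset.card = 2 * (k * r) := by
    rw [← G.sum_degrees_eq_twice_card_edges, Finset.sum_congr rfl fun u _ => hreg u,
      Finset.sum_const, Finset.card_univ, hr, smul_eq_mul]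
    ring
  have hV : Fintype.card V / 2 = r := by
    rw [card_eq_add_one_of_iso φ]
    omega
  rw [IsOverfull, P.maxDegree_of_iso hN₁ hN₂ φ hreg, hV, P.card_edgeFinset_of_iso φ]
  omega

end Splitting

end VertexSplitting

theorem theorem1 {W V : Type*} [Fintype W] [Fintype V]
    (n Δ : ℕ) (hn : 0 < n) (hΔ : 0 < Δ) (hbound : (2 * (n : ℚ) - 4) / 3 ≤ (Δ : ℚ))
    (G₀ : SimpleGraph W) [DecidableRel G₀.Adj] (hW : Fintype.card W = n - 1)
    (hconn : G₀.Connected) (hreg : G₀.IsRegularOfDegree Δ)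
    (hclass : VertexSplitting.IsClassOne G₀)
    (G : SimpleGraph V) [DecidableRel G.Adj] (hV : Fintype.card V = n)
    (hsplit : VertexSplitting.IsVertexSplitting G₀ G) :
    VertexSplitting.IsOverfull G ∧
    VertexSplitting.IsClassTwo G ∧
    (∀ e ∈ G.edgeSet, VertexSplitting.IsCriticalEdge G e) ∧
    VertexSplitting.IsDeltaCritical G Δ := by
  obtain ⟨v, N₁, N₂, hN₁, hN₂, hd, hN, ⟨φ⟩⟩ := hsplit
  have P : VertexSplitting.IsNeighborPartition G₀ v N₁ N₂ := ⟨hN, hd⟩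
  have : Nonempty W := ⟨v⟩
  have : Nonempty (Fin Δ) := ⟨⟨0, hΔ⟩⟩
  have hδ : 2 * Fintype.card W ≤ 3 * G₀.minDegree + 2 := by
    have : 2 * n ≤ 3 * Δ + 4 := by
      have : 2 * (n : ℚ) ≤ 3 * Δ + 4 := by linarith
      exact_mod_cast this
    rw [hreg.minDegree_eq]
    omega
  obtain ⟨f, hf⟩ := VertexSplitting.exists_isPoleColoring_of_isRegularOfDegree hreg hΔ <| by
    rw [← VertexSplitting.chromaticIndex_le_iff, hclass, hreg.maxDegree_eq]
  have hover : VertexSplitting.IsOverfull G := P.isOverfull_of_iso hN₁ hN₂ φ hreg hf.even_card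
  have hadj : ∀ u, ∃ y, G.Adj u y := P.exists_adj_of_iso φ fun u =>
    (G₀.degree_pos_iff_exists_adj u).1 (by rwa [hreg.degree_eq])
  obtain rfl : G.maxDegree = Δ := P.maxDegree_of_iso hN₁ hN₂ φ hreg
  have hdel : ∀ e ∈ G.edgeSet, (G.deleteEdges {e}).lineGraph.Colorable G.maxDegree := by
    rintro ⟨u, y⟩ he
    exact VertexSplitting.colorable_lineGraph_deleteEdges_of_iso φ
      (P.colorable_deleteEdges_splitGraph hN₁ hN₂ hδ hf (φ.map_adj_iff.2 he))
  exact ⟨hover, hover.isClassTwo, fun e he => hover.isCriticalEdge he (hdel e he),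
    hover.isDeltaCritical hadj hdel⟩
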